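/- **Setting.** Let $P$ be a set of generating objects and $\{E^i\mid i\in J\}$ a set of generating functors (both arbitrary, possibly empty). An endofunctor $E$ of a symmetric monoidal category (with $a_{A,B,C}\colon(A\otimes B)\otimes C\to A\otimes(B\otimes C)$, $l_A\colon I\otimes A\to A$, $r_A\colon A\otimes I\to A$, $c_{A,B}\colon A\otimes B\to B\otimes A$) is *locally linear* when it comes with natural transformations $\psi^L_{A,B}\colon EA\otimes B\to E(A\otimes B)$ and $\psi^R_{A,B}\colon A\otimes EB\to E(A\otimes B)$ such that $$\begin{aligned} Ea_{A,B,C}\circ\psi^L_{A\otimes B,C}\circ(\psi^L_{A,B}\otimes 1_C)&=\psi^L_{A,B\otimes C}\circ a_{EA,B,C}, & Er_A\circ\psi^L_{A,I}&=r_{EA},\\ Ea_{A,B,C}\circ\psi^R_{A\otimes B,C}&=\psi^R_{A,B\otimes C}\circ(1_A\otimes\psi^R_{B,C})\circ a_{A,B,EC}, & El_A\circ\psi^R_{I,A}&=l_{EA},\\ Ea_{A,B,C}\circ\psi^L_{A\otimes B,C}\circ(\psi^R_{A,B}\otimes 1_C)&=\psi^R_{A,B\otimes C}\circ(1_A\otimes\psi^L_{B,C})\circ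 a_{A,EB,C}, & Ec_{A,B}\circ\psi^L_{A,B}&=\psi^R_{B,A}\circ c_{EA,B}. \end{aligned}$$ Let $\mathcal L_c$ be the free symmetric monoidal category with a family of locally linear endofunctors generated by $P$ and $\{E^i\}$: its objects are the formulae built from the elements of $P$ and $I$ by $\otimes$ and the $E^i$, and its arrows are the equivalence classes of arrow terms built from $1,a^{\pm1},l^{\pm1},r^{\pm1},c,\psi^{L},\psi^{R}$ by $\circ$, $\otimes$ and the $E^i$, modulo the equations of symmetric monoidal categories, functoriality of the $E^i$, naturality of $\psi^L,\psi^R$ and the equations above. Let *Fun* be the category of functions between finite ordinals. The functor $G\colon\mathcal L_c\to\textit{Fun}$ sends a formula $A$ to the number of occurrences of generators (elements of $P$ and functors $E^i$) in $A$, numbered from left to right, and an arrow to the function that links the corresponding occurrences in source and target: $G$ of $1,a^{\pm1},l^{\pm1},r^{\pm1},\psi^L$ is an identity function, $Gc_{A,B}$ is the crossing of the block of $A$ with the block of $B$, $G\psi^R_{A,B}$ moves the outermost $E$ of $EB$ to the front and keeps the order of everything else, $G(f\otimes g)$ is the juxtaposition of $Gf$ and $Gg$, $GEf$ is the juxtaposition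 of the identity on one element and $Gf$, and $G(g\circ f)=Gg\circ Gf$. Call an arrow of $\mathcal L_c$ *canonical* if it is built from $1,a^{\pm1},l^{\pm1},r^{\pm1}$ by $\circ$, $\otimes$ and the $E^i$; the canonical arrows form a groupoid with at most one arrow of each type. The strictification $\mathcal L_c^{str}$ is obtained by turning all canonical arrows into identities: its objects are the classes of formulae linked by canonical arrows, its arrows are the classes of arrows of $\mathcal L_c$, where $f\colon A\to B$ and $f'\colon A'\to B'$ are identified when $s\circ f=f'\circ t$ for canonical $t\colon A\to A'$, $s\colon B\to B'$. Let $H\colon\mathcal L_c^{str}\to\mathcal L_c$ be the equivalence that sends each class of formulae to a chosen representative of it, and the class of $f$ to the composite of $f$ with the canonical arrows between its source and target and the chosen representatives. **Proposition 3 ($\mathcal L_c$-Coherence).** The functor $GH\colon\mathcal L_c^{str}\to\textit{Fun}$ is faithful; and so $G\colon\mathcal L_c\to\textit{Fun}$ is faithful ($\mathcal L_c$-Coherence). -/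

import Mathlib

open CategoryTheory MonoidalCategory

universe u v

/-! ## The category of functions between finite ordinals -/

/-- Finite ordinals `{0, …, card - 1}`, the objects of the category of functions between
finite ordinals. -/
structure FinOrdFun : Type where
  card : ℕ

instance : Category.{0} FinOrdFun where
  Hom m n := Fin m.card → Fin n.card
  id _ := fun x => x
  comp f g := fun x => g (f x)

namespace FinFun

/-- Side-by-side juxtaposition of two functions, `f` on the first block, `g` on the second. -/
def juxt {m m' n n' : ℕ} (f : Fin m → Fin m') (g : Fin n → Fin n') (x : Fin (m + n)) :
    Fin (m' + n') :=
  Fin.addCases (fun i => Fin.castAdd n' (f i)) (fun j => Fin.natAdd m' (g j)) x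

/-- The identity function, up to `(m + n) + k = m + (n + k)`. -/
def assoc (m n k : ℕ) (x : Fin (m + n + k)) : Fin (m + (n + k)) :=
  Fin.cast (Nat.add_assoc m n k) x

/-- The identity function, up to `m + (n + k) = (m + n) + k`. -/
def assocInv (m n k : ℕ) (x : Fin (m + (n + k))) : Fin (m + n + k) :=
  Fin.cast (Nat.add_assoc m n k).symm x

/-- The identity function, up to `0 + n = n`. -/
def left (n : ℕ) (x : Fin (0 + n)) : Fin n := Fin.cast (Nat.zero_add n) x

/-- The identity function, up to `n = 0 + n`. -/
def leftInv (n : ℕ) (x : Fin n) : Fin (0 + n) := Fin.cast (Nat.zero_add n).symm x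

/-- The identity function, up to `n + 0 = n`. -/
def right (n : ℕ) (x : Fin (n + 0)) : Fin n := Fin.cast (Nat.add_zero n) x

/-- The identity function, up to `n = n + 0`. -/
def rightInv (n : ℕ) (x : Fin n) : Fin (n + 0) := Fin.cast (Nat.add_zero n).symm x

/-- The crossing of a block of length `m` with a block of length `n`. -/
def flip (m n : ℕ) (x : Fin (m + n)) : Fin (n + m) :=
  Fin.addCases (fun i => Fin.natAdd n i) (fun j => Fin.castAdd m j) x

/-- The bijection which moves the element after the first `m` ones to the front, and keeps the
order of all the others. -/
def toFront (m n : ℕ) (x : Fin (m + (1 + n))) : Fin (1 + (m + n)) :=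
  assoc 1 m n (juxt (flip m 1) (fun y => y) (assocInv m 1 n x))

section
variable {m m' n n' k : ℕ}

@[simp] theorem juxt_castAdd (f : Fin m → Fin m') (g : Fin n → Fin n') (i : Fin m) :
    juxt f g (Fin.castAdd n i) = Fin.castAdd n' (f i) := by simp [juxt]

@[simp] theorem juxt_natAdd (f : Fin m → Fin m') (g : Fin n → Fin n') (j : Fin n) :
    juxt f g (Fin.natAdd m j) = Fin.natAdd m' (g j) := by simp [juxt]

@[simp] theorem flip_castAdd (i : Fin m) : flip m n (Fin.castAdd n i) = Fin.natAdd n i := by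
  simp [flip]

@[simp] theorem flip_natAdd (j : Fin n) : flip m n (Fin.natAdd m j) = Fin.castAdd m j := by
  simp [flip]

@[simp] theorem assoc_one (i : Fin m) :
    assoc m n k (Fin.castAdd k (Fin.castAdd n i)) = Fin.castAdd (n + k) i := rfl

@[simp] theorem assoc_two (i : Fin n) :
    assoc m n k (Fin.castAdd k (Fin.natAdd m i)) = Fin.natAdd m (Fin.castAdd k i) := rfl

@[simp] theorem assoc_three (i : Fin k) :
    assoc m n k (Fin.natAdd (m + n) i) = Fin.natAdd m (Fin.natAdd n i) := by
  ext; simp [assoc, Nat.add_assoc]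

@[simp] theorem assocInv_one (i : Fin m) :
    assocInv m n k (Fin.castAdd (n + k) i) = Fin.castAdd k (Fin.castAdd n i) := rfl

@[simp] theorem assocInv_two (i : Fin n) :
    assocInv m n k (Fin.natAdd m (Fin.castAdd k i)) = Fin.castAdd k (Fin.natAdd m i) := rfl

@[simp] theorem assocInv_three (i : Fin k) :
    assocInv m n k (Fin.natAdd m (Fin.natAdd n i)) = Fin.natAdd (m + n) i := by
  ext; simp [assocInv, Nat.add_assoc]

@[simp] theorem left_natAdd (i : Fin n) : left n (Fin.natAdd 0 i) = i := by
  ext; simp [left]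

@[simp] theorem leftInv_eq (i : Fin n) : leftInv n i = Fin.natAdd 0 i := by
  ext; simp [leftInv]

@[simp] theorem right_castAdd (i : Fin n) : right n (Fin.castAdd 0 i) = i := rfl

@[simp] theorem rightInv_eq (i : Fin n) : rightInv n i = Fin.castAdd 0 i := rfl

@[simp] theorem toFront_one (i : Fin m) :
    toFront m n (Fin.castAdd (1 + n) i) = Fin.natAdd 1 (Fin.castAdd n i) := by
  simp [toFront]

@[simp] theorem toFront_two (i : Fin 1) :
    toFront m n (Fin.natAdd m (Fin.castAdd n i)) = Fin.castAdd (m + n) i := by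
  simp [toFront]

@[simp] theorem toFront_three (i : Fin n) :
    toFront m n (Fin.natAdd m (Fin.natAdd 1 i)) = Fin.natAdd 1 (Fin.natAdd m i) := by
  simp [toFront]

theorem forall_add {p : Fin (m + n) → Prop} :
    (∀ x, p x) ↔ (∀ i, p (Fin.castAdd n i)) ∧ ∀ j, p (Fin.natAdd m j) :=
  ⟨fun h => ⟨fun _ => h _, fun _ => h _⟩, fun h x => Fin.addCases h.1 h.2 x⟩

end

end FinFun

/-! ## The strictification of a category along a preordered groupoid subcategory -/

/-- A subcategory with all objects which is a groupoid and a preorder: it contains the identities,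
is closed under composition and under inverses, and has at most one arrow of each type. -/
structure IsPreorderedGroupoid {C : Type u} [Category.{v} C] (W : MorphismProperty C) : Prop where
  id_mem : ∀ A : C, W (𝟙 A)
  comp_mem : ∀ {A B D : C} (f : A ⟶ B) (g : B ⟶ D), W f → W g → W (f ≫ g)
  inv_mem : ∀ {A B : C} (f : A ⟶ B), W f → ∃ g : B ⟶ A, W g ∧ f ≫ g = 𝟙 A ∧ g ≫ f = 𝟙 B
  preorder : ∀ {A B : C} (f g : A ⟶ B), W f → W g → f = g

namespace IsPreorderedGroupoid

variable {C : Type u} [Category.{v} C] {W : MorphismProperty C}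

/-- Two objects are identified in the strictification when there is an arrow of the groupoid
between them. -/
def setoid (h : IsPreorderedGroupoid W) : Setoid C where
  r A B := ∃ f : A ⟶ B, W f
  iseqv :=
    { refl := fun A => ⟨𝟙 A, h.id_mem A⟩
      symm := fun ⟨f, hf⟩ => ⟨(h.inv_mem f hf).choose, (h.inv_mem f hf).choose_spec.1⟩
      trans := fun ⟨f, hf⟩ ⟨g, hg⟩ => ⟨f ≫ g, h.comp_mem f g hf hg⟩ }

/-- The objects of the strictification: equivalence classes of objects. -/
structure Strict (h : IsPreorderedGroupoid W) : Type u where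
  cls : Quotient h.setoid

/-- The equivalence class of an object. -/
def obj (h : IsPreorderedGroupoid W) (A : C) : h.Strict := ⟨Quotient.mk h.setoid A⟩

theorem exists_of_obj_eq (h : IsPreorderedGroupoid W) {A B : C} (e : h.obj A = h.obj B) :
    ∃ f : A ⟶ B, W f :=
  Quotient.exact (s := h.setoid) (congrArg Strict.cls e)

/-- The unique arrow of the groupoid between two objects of the same class. -/
noncomputable def link (h : IsPreorderedGroupoid W) {A B : C} (e : h.obj A = h.obj B) : A ⟶ B :=
  (h.exists_of_obj_eq e).choose

theorem link_mem (h : IsPreorderedGroupoid W) {A B : C} (e : h.obj A = h.obj B) : W (h.link e) :=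
  (h.exists_of_obj_eq e).choose_spec

theorem link_comp_link (h : IsPreorderedGroupoid W) {A B D : C} (e : h.obj A = h.obj B)
    (e' : h.obj B = h.obj D) : h.link e ≫ h.link e' = h.link (e.trans e') :=
  h.preorder _ _ (h.comp_mem _ _ (h.link_mem e) (h.link_mem e')) (h.link_mem _)

theorem link_comp_link_assoc (h : IsPreorderedGroupoid W) {A B D F : C} (e : h.obj A = h.obj B)
    (e' : h.obj B = h.obj D) (f : D ⟶ F) :
    h.link e ≫ h.link e' ≫ f = h.link (e.trans e') ≫ f := by
  rw [← Category.assoc, link_comp_link]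

theorem link_refl (h : IsPreorderedGroupoid W) {A : C} (e : h.obj A = h.obj A) :
    h.link e = 𝟙 A :=
  h.preorder _ _ (h.link_mem e) (h.id_mem A)

/-- The arrows of `C` whose source and target belong to two given classes. -/
structure Rep (h : IsPreorderedGroupoid W) (X Y : h.Strict) : Type (max u v) where
  src : C
  tgt : C
  src_eq : h.obj src = X
  tgt_eq : h.obj tgt = Y
  arrow : src ⟶ tgt

/-- Two arrows `f : A ⟶ B` and `f' : A' ⟶ B'` are identified in the strictification when
`f ≫ s = t ≫ f'` for the arrows `s : B ⟶ B'` and `t : A ⟶ A'` of the groupoid. -/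
def homSetoid (h : IsPreorderedGroupoid W) (X Y : h.Strict) : Setoid (h.Rep X Y) where
  r f f' := f.arrow ≫ h.link (f.tgt_eq.trans f'.tgt_eq.symm) =
    h.link (f.src_eq.trans f'.src_eq.symm) ≫ f'.arrow
  iseqv :=
    { refl := fun f => by simp [link_refl]
      symm := fun {f f'} e => by
        have e1 := congrArg (fun z => h.link (f'.src_eq.trans f.src_eq.symm) ≫ z ≫
          h.link (f'.tgt_eq.trans f.tgt_eq.symm)) e
        simp only [Category.assoc, link_comp_link, link_comp_link_assoc, link_refl,
          Category.comp_id, Category.id_comp] at e1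
        exact e1.symm
      trans := fun {f f' f''} e e' => by
        rw [← h.link_comp_link (f.tgt_eq.trans f'.tgt_eq.symm)
          (f'.tgt_eq.trans f''.tgt_eq.symm), ← Category.assoc, e, Category.assoc, e',
          link_comp_link_assoc] }

theorem comp_congr_aux (h : IsPreorderedGroupoid W) {A B D F A' B' D' F' : C} {f : A ⟶ B}
    {g : D ⟶ F} {f' : A' ⟶ B'} {g' : D' ⟶ F'} {eA : h.obj A = h.obj A'}
    {eB : h.obj B = h.obj B'} {eD : h.obj D = h.obj D'} {eF : h.obj F = h.obj F'}
    (e : f ≫ h.link eB = h.link eA ≫ f') (e' : g ≫ h.link eF = h.link eD ≫ g')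
    (k : h.obj B = h.obj D) (k' : h.obj B' = h.obj D') :
    (f ≫ h.link k ≫ g) ≫ h.link eF = h.link eA ≫ f' ≫ h.link k' ≫ g' := by
  rw [Category.assoc, Category.assoc, e', ← Category.assoc (h.link eA) f', ← e,
    Category.assoc, link_comp_link_assoc, link_comp_link_assoc]

theorem eq_aux (h : IsPreorderedGroupoid W) {A B : C} {f g : A ⟶ B} (e : f = g)
    (e1 : h.obj A = h.obj A) (e2 : h.obj B = h.obj B) : f ≫ h.link e2 = h.link e1 ≫ g := by
  rw [e, link_refl, link_refl, Category.comp_id, Category.id_comp]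

theorem refl_aux (h : IsPreorderedGroupoid W) {A B : C} (f : A ⟶ B)
    (e1 : h.obj A = h.obj A) (e2 : h.obj B = h.obj B) : h.link e1 ≫ f ≫ h.link e2 = f := by
  rw [link_refl, link_refl, Category.comp_id, Category.id_comp]

theorem id_comp_aux (h : IsPreorderedGroupoid W) {A B D : C} {f : A ⟶ B}
    (e1 : h.obj D = h.obj A) (e2 : h.obj B = h.obj B) :
    (𝟙 D ≫ h.link e1 ≫ f) ≫ h.link e2 = h.link e1 ≫ f := by
  rw [link_refl, Category.comp_id, Category.id_comp]

theorem comp_id_aux (h : IsPreorderedGroupoid W) {A B D : C} {f : A ⟶ B}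
    (e1 : h.obj B = h.obj D) (e2 : h.obj D = h.obj B) (e3 : h.obj A = h.obj A) :
    (f ≫ h.link e1 ≫ 𝟙 D) ≫ h.link e2 = h.link e3 ≫ f := by
  rw [link_refl, Category.comp_id, Category.id_comp, Category.assoc, link_comp_link, link_refl,
    Category.comp_id]

/-- Composition: representatives are composed through the arrow of the groupoid which links
the target of the first with the source of the second. -/
noncomputable def compRep (h : IsPreorderedGroupoid W) {X Y Z : h.Strict} (f : h.Rep X Y)
    (g : h.Rep Y Z) : h.Rep X Z :=
  ⟨f.src, g.tgt, f.src_eq, g.tgt_eq,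
    f.arrow ≫ h.link (f.tgt_eq.trans g.src_eq.symm) ≫ g.arrow⟩

/-- The strictification: equivalence classes of objects and of arrows. -/
noncomputable instance (h : IsPreorderedGroupoid W) : Category.{max u v} h.Strict where
  Hom X Y := Quotient (h.homSetoid X Y)
  id X := Quotient.mk (h.homSetoid X X) ⟨X.cls.out, X.cls.out,
    by cases X; simp [obj], by cases X; simp [obj], 𝟙 _⟩
  comp {X Y Z} := Quotient.map₂ h.compRep fun _ _ e _ _ e' => h.comp_congr_aux e e' _ _
  id_comp := by
    rintro X Y ⟨f⟩
    exact Quotient.sound (h.id_comp_aux (f := f.arrow) _ _)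
  comp_id := by
    rintro X Y ⟨f⟩
    exact Quotient.sound (h.comp_id_aux (f := f.arrow) _ _ _)
  assoc := by
    rintro X Y Z T ⟨f⟩ ⟨g⟩ ⟨k⟩
    refine Quotient.sound (h.eq_aux ?_ _ _)
    change (f.arrow ≫ h.link _ ≫ g.arrow) ≫ h.link _ ≫ k.arrow =
      f.arrow ≫ h.link _ ≫ g.arrow ≫ h.link _ ≫ k.arrow
    rw [Category.assoc, Category.assoc]

/-- The class of an arrow. -/
def cls (h : IsPreorderedGroupoid W) {A B : C} (f : A ⟶ B) : h.obj A ⟶ h.obj B :=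
  Quotient.mk (h.homSetoid _ _) ⟨A, B, rfl, rfl, f⟩

/-- The chosen representative of a class of objects. -/
noncomputable def rep (h : IsPreorderedGroupoid W) (X : h.Strict) : C := X.cls.out

theorem obj_rep (h : IsPreorderedGroupoid W) (X : h.Strict) : h.obj (h.rep X) = X := by
  cases X; simp [obj, rep]

/-- The functor from the strictification back to `C`: a class of objects goes to its chosen
representative, and the class of `f : A ⟶ B` goes to the composite of `f` with the arrows of the
groupoid that link `A` and `B` with the representatives of their classes. -/
noncomputable def fromStrict (h : IsPreorderedGroupoid W) : h.Strict ⥤ C where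
  obj X := h.rep X
  map {X Y} := Quotient.lift
    (fun f : h.Rep X Y => h.link ((h.obj_rep X).trans f.src_eq.symm) ≫ f.arrow ≫
      h.link (f.tgt_eq.trans (h.obj_rep Y).symm))
    (by
      intro f f' e
      change f.arrow ≫ h.link _ = h.link _ ≫ f'.arrow at e
      rw [← h.link_comp_link (f.tgt_eq.trans f'.tgt_eq.symm)
        (f'.tgt_eq.trans (h.obj_rep Y).symm), ← Category.assoc f.arrow, e, Category.assoc,
        link_comp_link_assoc])
  map_id X := by
    change h.link _ ≫ 𝟙 _ ≫ h.link _ = 𝟙 _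
    rw [Category.id_comp, link_comp_link, link_refl]
  map_comp := by
    rintro X Y Z ⟨f⟩ ⟨g⟩
    change h.link _ ≫ (f.arrow ≫ h.link _ ≫ g.arrow) ≫ h.link _ =
      (h.link _ ≫ f.arrow ≫ h.link _) ≫ (h.link _ ≫ g.arrow ≫ h.link _)
    simp only [Category.assoc, link_comp_link_assoc]

/-- The functor from `C` to the strictification, taking objects and arrows to their classes. -/
noncomputable def toStrict (h : IsPreorderedGroupoid W) : C ⥤ h.Strict where
  obj A := h.obj A
  map f := h.cls f
  map_id A := by
    refine Quotient.sound ?_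
    change 𝟙 _ ≫ h.link _ = h.link _ ≫ 𝟙 _
    rw [Category.id_comp, Category.comp_id]
  map_comp f g := by
    refine Quotient.sound (h.eq_aux ?_ _ _)
    change f ≫ g = f ≫ h.link _ ≫ g
    rw [link_refl, Category.id_comp]

/-- The arrows of the groupoid become identities in the strictification. -/
theorem toStrict_map_eq (h : IsPreorderedGroupoid W) {A B : C} (f : A ⟶ B) (hf : W f)
    (e : h.obj A = h.obj B) : h.toStrict.map f = eqToHom e := by
  have gen : ∀ {Y : h.Strict} (q : h.obj A = Y), eqToHom q =
      Quotient.mk (h.homSetoid (h.obj A) Y) ⟨A, A, rfl, q, 𝟙 A⟩ := by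
    rintro _ rfl
    exact ((h.toStrict).map_id A).symm
  rw [gen e]
  refine Quotient.sound ?_
  change f ≫ h.link _ = h.link _ ≫ 𝟙 A
  exact h.preorder _ _ (h.comp_mem _ _ hf (h.link_mem _))
    (h.comp_mem _ _ (h.link_mem _) (h.id_mem A))

/-- The strictification is equivalent to the original category. -/
theorem fromStrict_isEquivalence (h : IsPreorderedGroupoid W) : h.fromStrict.IsEquivalence where
  faithful := ⟨by
    rintro X Y ⟨f⟩ ⟨g⟩ e
    refine Quotient.sound ?_
    change h.link _ ≫ f.arrow ≫ h.link _ = h.link _ ≫ g.arrow ≫ h.link _ at e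
    change f.arrow ≫ h.link _ = h.link _ ≫ g.arrow
    have e1 := congrArg (fun z => h.link (f.src_eq.trans (h.obj_rep X).symm) ≫ z ≫
      h.link ((h.obj_rep Y).trans g.tgt_eq.symm)) e
    simpa only [Category.assoc, link_comp_link, link_comp_link_assoc, link_refl,
      Category.comp_id, Category.id_comp] using e1⟩
  full := ⟨by
    intro X Y k
    refine ⟨Quotient.mk (h.homSetoid X Y) ⟨h.rep X, h.rep Y, h.obj_rep X, h.obj_rep Y, k⟩, ?_⟩
    exact h.refl_aux (A := h.rep X) (B := h.rep Y) k _ _⟩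
  essSurj := ⟨fun A => ⟨h.obj A, ⟨
    { hom := h.link (h.obj_rep (h.obj A))
      inv := h.link (h.obj_rep (h.obj A)).symm
      hom_inv_id := (h.link_comp_link _ _).trans (h.link_refl _)
      inv_hom_id := (h.link_comp_link _ _).trans (h.link_refl _) }⟩⟩⟩

end IsPreorderedGroupoid

/-! ## The free symmetric monoidal category with a family of locally linear endofunctors -/

namespace LocallyLinear

/-- Propositional formulae over a set `P` of generating objects and a family of generating
functors indexed by `J`. -/
inductive Formula (P : Type u) (J : Type v) : Type (max u v)
  | var (p : P) : Formula P J
  | unit : Formula P J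
  | tensor (A B : Formula P J) : Formula P J
  | fn (i : J) (A : Formula P J) : Formula P J

variable {P : Type u} {J : Type v}

local infixr:70 " ⊠ " => Formula.tensor

/-- Arrow terms. `psiL i A B : Eⁱ A ⊗ B → Eⁱ (A ⊗ B)` and `psiR i A B : A ⊗ Eⁱ B → Eⁱ (A ⊗ B)`;
composition is written in diagrammatic order. -/
inductive Term : Formula P J → Formula P J → Type (max u v)
  | id (A : Formula P J) : Term A A
  | comp {A B C : Formula P J} (f : Term A B) (g : Term B C) : Term A C
  | tensor {A A' B B' : Formula P J} (f : Term A A') (g : Term B B') : Term (A ⊠ B) (A' ⊠ B')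
  | fn (i : J) {A B : Formula P J} (f : Term A B) : Term (.fn i A) (.fn i B)
  | a (A B C : Formula P J) : Term ((A ⊠ B) ⊠ C) (A ⊠ (B ⊠ C))
  | aInv (A B C : Formula P J) : Term (A ⊠ (B ⊠ C)) ((A ⊠ B) ⊠ C)
  | l (A : Formula P J) : Term (.unit ⊠ A) A
  | lInv (A : Formula P J) : Term A (.unit ⊠ A)
  | r (A : Formula P J) : Term (A ⊠ .unit) A
  | rInv (A : Formula P J) : Term A (A ⊠ .unit)
  | c (A B : Formula P J) : Term (A ⊠ B) (B ⊠ A)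
  | psiL (i : J) (A B : Formula P J) : Term (.fn i A ⊠ B) (.fn i (A ⊠ B))
  | psiR (i : J) (A B : Formula P J) : Term (A ⊠ .fn i B) (.fn i (A ⊠ B))

local infixr:60 " ⨟ " => Term.comp
local infixr:70 " ⊡ " => Term.tensor

/-- The equations between arrow terms: the congruence generated by the equations of symmetric
monoidal categories, the functoriality of the `Eⁱ`, and the naturality and coherence equations of
locally linear endofunctors. -/
inductive Rel : ∀ {A B : Formula P J}, Term A B → Term A B → Prop
  -- congruence
  | refl {A B : Formula P J} (f : Term A B) : Rel f f
  | symm {A B : Formula P J} {f g : Term A B} : Rel f g → Rel g f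
  | trans {A B : Formula P J} {f g h : Term A B} : Rel f g → Rel g h → Rel f h
  | comp_congr {A B C : Formula P J} {f f' : Term A B} {g g' : Term B C} :
      Rel f f' → Rel g g' → Rel (f ⨟ g) (f' ⨟ g')
  | tensor_congr {A A' B B' : Formula P J} {f f' : Term A A'} {g g' : Term B B'} :
      Rel f f' → Rel g g' → Rel (f ⊡ g) (f' ⊡ g')
  | fn_congr (i : J) {A B : Formula P J} {f f' : Term A B} :
      Rel f f' → Rel (.fn i f) (.fn i f')
  -- category
  | id_comp {A B : Formula P J} (f : Term A B) : Rel (.id A ⨟ f) f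
  | comp_id {A B : Formula P J} (f : Term A B) : Rel (f ⨟ .id B) f
  | assoc {A B C D : Formula P J} (f : Term A B) (g : Term B C) (h : Term C D) :
      Rel ((f ⨟ g) ⨟ h) (f ⨟ (g ⨟ h))
  -- functoriality of the tensor and of the endofunctors
  | tensor_id (A B : Formula P J) : Rel (.id A ⊡ .id B) (.id (A ⊠ B))
  | tensor_comp {A A' A'' B B' B'' : Formula P J} (f : Term A A') (f' : Term A' A'')
      (g : Term B B') (g' : Term B' B'') : Rel ((f ⨟ f') ⊡ (g ⨟ g')) ((f ⊡ g) ⨟ (f' ⊡ g'))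
  | fn_id (i : J) (A : Formula P J) : Rel (.fn i (.id A)) (.id (.fn i A))
  | fn_comp (i : J) {A B C : Formula P J} (f : Term A B) (g : Term B C) :
      Rel (.fn i (f ⨟ g)) (.fn i f ⨟ .fn i g)
  -- natural isomorphisms
  | a_natural {A A' B B' C C' : Formula P J} (f : Term A A') (g : Term B B') (h : Term C C') :
      Rel (((f ⊡ g) ⊡ h) ⨟ .a A' B' C') (.a A B C ⨟ (f ⊡ (g ⊡ h)))
  | a_aInv (A B C : Formula P J) : Rel (.a A B C ⨟ .aInv A B C) (.id _)
  | aInv_a (A B C : Formula P J) : Rel (.aInv A B C ⨟ .a A B C) (.id _)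
  | l_natural {A A' : Formula P J} (f : Term A A') : Rel ((.id .unit ⊡ f) ⨟ .l A') (.l A ⨟ f)
  | l_lInv (A : Formula P J) : Rel (.l A ⨟ .lInv A) (.id _)
  | lInv_l (A : Formula P J) : Rel (.lInv A ⨟ .l A) (.id _)
  | r_natural {A A' : Formula P J} (f : Term A A') : Rel ((f ⊡ .id .unit) ⨟ .r A') (.r A ⨟ f)
  | r_rInv (A : Formula P J) : Rel (.r A ⨟ .rInv A) (.id _)
  | rInv_r (A : Formula P J) : Rel (.rInv A ⨟ .r A) (.id _)
  | c_natural {A A' B B' : Formula P J} (f : Term A A') (g : Term B B') :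
      Rel ((f ⊡ g) ⨟ .c A' B') (.c A B ⨟ (g ⊡ f))
  -- Mac Lane's coherence conditions
  | pentagon (A B C D : Formula P J) :
      Rel ((.a A B C ⊡ .id D) ⨟ (.a A (B ⊠ C) D ⨟ (.id A ⊡ .a B C D)))
        (.a (A ⊠ B) C D ⨟ .a A B (C ⊠ D))
  | triangle (A B : Formula P J) : Rel (.a A .unit B ⨟ (.id A ⊡ .l B)) (.r A ⊡ .id B)
  | l_unit : Rel (.l .unit) (.r .unit)
  | c_c (A B : Formula P J) : Rel (.c A B ⨟ .c B A) (.id _)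
  | c_unit (A : Formula P J) : Rel (.c A .unit ⨟ .l A) (.r A)
  | hexagon (A B C : Formula P J) :
      Rel (.a A B C ⨟ (.c A (B ⊠ C) ⨟ .a B C A))
        ((.c A B ⊡ .id C) ⨟ (.a B A C ⨟ (.id B ⊡ .c A C)))
  -- left monoidal endofunctors
  | psiL_natural (i : J) {A A' B B' : Formula P J} (f : Term A A') (g : Term B B') :
      Rel ((.fn i f ⊡ g) ⨟ .psiL i A' B') (.psiL i A B ⨟ .fn i (f ⊡ g))
  | psiL_a (i : J) (A B C : Formula P J) :
      Rel ((.psiL i A B ⊡ .id C) ⨟ (.psiL i (A ⊠ B) C ⨟ .fn i (.a A B C)))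
        (.a (.fn i A) B C ⨟ .psiL i A (B ⊠ C))
  | psiL_r (i : J) (A : Formula P J) : Rel (.psiL i A .unit ⨟ .fn i (.r A)) (.r (.fn i A))
  -- right monoidal endofunctors
  | psiR_natural (i : J) {A A' B B' : Formula P J} (f : Term A A') (g : Term B B') :
      Rel ((f ⊡ .fn i g) ⨟ .psiR i A' B') (.psiR i A B ⨟ .fn i (f ⊡ g))
  | psiR_a (i : J) (A B C : Formula P J) :
      Rel (.psiR i (A ⊠ B) C ⨟ .fn i (.a A B C))
        (.a A B (.fn i C) ⨟ ((.id A ⊡ .psiR i B C) ⨟ .psiR i A (B ⊠ C)))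
  | psiR_l (i : J) (A : Formula P J) : Rel (.psiR i .unit A ⨟ .fn i (.l A)) (.l (.fn i A))
  -- locally monoidal endofunctors
  | psiL_psiR_a (i : J) (A B C : Formula P J) :
      Rel ((.psiR i A B ⊡ .id C) ⨟ (.psiL i (A ⊠ B) C ⨟ .fn i (.a A B C)))
        (.a A (.fn i B) C ⨟ ((.id A ⊡ .psiL i B C) ⨟ .psiR i A (B ⊠ C)))
  -- locally linear endofunctors
  | psiL_psiR_c (i : J) (A B : Formula P J) :
      Rel (.psiL i A B ⨟ .fn i (.c A B)) (.c (.fn i A) B ⨟ .psiR i B A)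

/-- Equality of arrow terms of a given type. -/
def termSetoid (A B : Formula P J) : Setoid (Term A B) where
  r := Rel
  iseqv := ⟨Rel.refl, Rel.symm, Rel.trans⟩

/-- The free symmetric monoidal category with a family of locally linear endofunctors: its objects
are the formulae, its arrows the equivalence classes of arrow terms. -/
instance : Category.{max u v} (Formula P J) where
  Hom A B := Quotient (termSetoid A B)
  id A := Quotient.mk _ (.id A)
  comp {A B C} := Quotient.map₂ Term.comp fun _ _ h _ _ h' => Rel.comp_congr h h'
  id_comp := by rintro A B ⟨f⟩; exact Quotient.sound (Rel.id_comp f)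
  comp_id := by rintro A B ⟨f⟩; exact Quotient.sound (Rel.comp_id f)
  assoc := by rintro A B C D ⟨f⟩ ⟨g⟩ ⟨h⟩; exact Quotient.sound (Rel.assoc f g h)

/-- The arrow named by an arrow term. -/
def arrow {A B : Formula P J} (f : Term A B) : A ⟶ B := Quotient.mk (termSetoid A B) f

/-- The tensor product of arrows. -/
def tensorMap {A A' B B' : Formula P J} :
    (A ⟶ A') → (B ⟶ B') → ((A ⊠ B) ⟶ (A' ⊠ B')) :=
  Quotient.map₂ Term.tensor fun _ _ h _ _ h' => Rel.tensor_congr h h'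

/-- The endofunctor `Eⁱ` on arrows. -/
def fnMap (i : J) {A B : Formula P J} : (A ⟶ B) → (Formula.fn i A ⟶ Formula.fn i B) :=
  Quotient.map (Term.fn i) fun _ _ h => Rel.fn_congr i h

/-- The monoidal structure. -/
instance : MonoidalCategory (Formula P J) :=
  letI : MonoidalCategoryStruct (Formula P J) :=
    { tensorObj := Formula.tensor
      tensorUnit := Formula.unit
      tensorHom := tensorMap
      whiskerLeft := fun A _ _ f => tensorMap (𝟙 A) f
      whiskerRight := fun f B => tensorMap f (𝟙 B)
      associator := fun A B C => ⟨arrow (.a A B C), arrow (.aInv A B C),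
        Quotient.sound (Rel.a_aInv A B C), Quotient.sound (Rel.aInv_a A B C)⟩
      leftUnitor := fun A => ⟨arrow (.l A), arrow (.lInv A),
        Quotient.sound (Rel.l_lInv A), Quotient.sound (Rel.lInv_l A)⟩
      rightUnitor := fun A => ⟨arrow (.r A), arrow (.rInv A),
        Quotient.sound (Rel.r_rInv A), Quotient.sound (Rel.rInv_r A)⟩ }
  MonoidalCategory.ofTensorHom
    (id_tensorHom_id := fun A B => Quotient.sound (Rel.tensor_id A B))
    (id_tensorHom := fun _ _ _ _ => rfl)
    (tensorHom_id := fun _ _ => rfl)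
    (tensorHom_comp_tensorHom := by
      rintro _ _ _ _ _ _ ⟨f₁⟩ ⟨f₂⟩ ⟨g₁⟩ ⟨g₂⟩
      exact Quotient.sound (Rel.symm (Rel.tensor_comp f₁ g₁ f₂ g₂)))
    (associator_naturality := by
      rintro _ _ _ _ _ _ ⟨f⟩ ⟨g⟩ ⟨h⟩
      exact Quotient.sound (Rel.a_natural f g h))
    (leftUnitor_naturality := by
      rintro _ _ ⟨f⟩
      exact Quotient.sound (Rel.l_natural f))
    (rightUnitor_naturality := by
      rintro _ _ ⟨f⟩
      exact Quotient.sound (Rel.r_natural f))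
    (pentagon := fun A B C D => Quotient.sound (Rel.pentagon A B C D))
    (triangle := fun A B => Quotient.sound (Rel.triangle A B))

/-- The endofunctor `Eⁱ`. -/
def fnFunctor (i : J) : Formula P J ⥤ Formula P J where
  obj := Formula.fn i
  map := fnMap i
  map_id A := Quotient.sound (Rel.fn_id i A)
  map_comp := by rintro A B C ⟨f⟩ ⟨g⟩; exact Quotient.sound (Rel.fn_comp i f g)

/-! ### The functor to functions between finite ordinals -/

/-- The number of occurrences of generators, objects as well as functors, in a formula. -/
def size : Formula P J → ℕ
  | .var _ => 1
  | .unit => 0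
  | .tensor A B => size A + size B
  | .fn _ A => 1 + size A

/-- The graph of an arrow term: the function from the occurrences of generators in its source
to those in its target, both numbered from left to right. -/
def graph : ∀ {A B : Formula P J}, Term A B → Fin (size A) → Fin (size B)
  | _, _, .id _ => fun x => x
  | _, _, .comp f g => fun x => graph g (graph f x)
  | _, _, .tensor f g => FinFun.juxt (graph f) (graph g)
  | _, _, .fn _ f => FinFun.juxt (fun x : Fin 1 => x) (graph f)
  | _, _, .a A B C => FinFun.assoc (size A) (size B) (size C)
  | _, _, .aInv A B C => FinFun.assocInv (size A) (size B) (size C)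
  | _, _, .l A => FinFun.left (size A)
  | _, _, .lInv A => FinFun.leftInv (size A)
  | _, _, .r A => FinFun.right (size A)
  | _, _, .rInv A => FinFun.rightInv (size A)
  | _, _, .c A B => FinFun.flip (size A) (size B)
  | _, _, .psiL _ A B => FinFun.assoc 1 (size A) (size B)
  | _, _, .psiR _ A B => FinFun.toFront (size A) (size B)

open FinFun in
theorem graph_eq {A B : Formula P J} {f g : Term A B} (h : Rel f g) : graph f = graph g := by
  induction h with
  | refl => rfl
  | symm _ ih => exact ih.symm
  | trans _ _ ih ih' => exact ih.trans ih'
  | comp_congr _ _ ih ih' => simp only [graph, ih, ih']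
  | tensor_congr _ _ ih ih' => exact congrArg₂ juxt ih ih'
  | fn_congr _ _ ih => exact congrArg (juxt fun x => x) ih
  | _ =>
    rw [funext_iff]
    simp [graph, size, forall_add, -Fin.castAdd_zero, -Fin.natAdd_zero, -Fin.natAdd_eq_addNat,
      -Nat.add_zero, -add_zero]

/-- The functor `G`. -/
def G (P : Type u) (J : Type v) : Formula P J ⥤ FinOrdFun where
  obj A := ⟨size A⟩
  map {A B} := Quotient.lift (fun f : Term A B => graph f) fun _ _ h => graph_eq h
  map_id _ := rfl
  map_comp := by rintro A B C ⟨f⟩ ⟨g⟩; rfl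

/-! ### The strictification -/

/-- The arrows made of `1`, `a`, `l`, `r` and the inverses of `a`, `l`, `r` by composition, `⊗` and
the endofunctors `Eⁱ`, i.e. the arrows that come from the free monoidal category with a family of
endofunctors. -/
inductive Canonical : MorphismProperty (Formula P J)
  | id (A : Formula P J) : Canonical (𝟙 A)
  | comp {A B C : Formula P J} (f : A ⟶ B) (g : B ⟶ C) :
      Canonical f → Canonical g → Canonical (f ≫ g)
  | tensor {A A' B B' : Formula P J} (f : A ⟶ A') (g : B ⟶ B') :
      Canonical f → Canonical g → Canonical (f ⊗ₘ g)
  | fn (i : J) {A B : Formula P J} (f : A ⟶ B) : Canonical f → Canonical ((fnFunctor i).map f)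
  | a (A B C : Formula P J) : Canonical (α_ A B C).hom
  | aInv (A B C : Formula P J) : Canonical (α_ A B C).inv
  | l (A : Formula P J) : Canonical (λ_ A).hom
  | lInv (A : Formula P J) : Canonical (λ_ A).inv
  | r (A : Formula P J) : Canonical (ρ_ A).hom
  | rInv (A : Formula P J) : Canonical (ρ_ A).inv

theorem canonical_inv {A B : Formula P J} {f : A ⟶ B} (hf : Canonical f) :
    ∃ g : B ⟶ A, Canonical g ∧ f ≫ g = 𝟙 A ∧ g ≫ f = 𝟙 B := by
  induction hf with
  | id A => exact ⟨𝟙 A, .id A, by simp, by simp⟩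
  | comp f g _ _ ihf ihg =>
    obtain ⟨f', hf', h1, h2⟩ := ihf
    obtain ⟨g', hg', h3, h4⟩ := ihg
    refine ⟨g' ≫ f', .comp _ _ hg' hf', ?_, ?_⟩
    · rw [Category.assoc, ← Category.assoc g, h3, Category.id_comp, h1]
    · rw [Category.assoc, ← Category.assoc f', h2, Category.id_comp, h4]
  | tensor f g _ _ ihf ihg =>
    obtain ⟨f', hf', h1, h2⟩ := ihf
    obtain ⟨g', hg', h3, h4⟩ := ihg
    refine ⟨f' ⊗ₘ g', .tensor _ _ hf' hg', ?_, ?_⟩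
    · rw [tensorHom_comp_tensorHom, h1, h3, id_tensorHom_id]
    · rw [tensorHom_comp_tensorHom, h2, h4, id_tensorHom_id]
  | fn i f _ ih =>
    obtain ⟨f', hf', h1, h2⟩ := ih
    refine ⟨(fnFunctor i).map f', .fn i _ hf', ?_, ?_⟩
    · rw [← Functor.map_comp, h1]; exact CategoryTheory.Functor.map_id (fnFunctor i) _
    · rw [← Functor.map_comp, h2]; exact CategoryTheory.Functor.map_id (fnFunctor i) _
  | a A B C => exact ⟨_, .aInv A B C, by simp, by simp⟩
  | aInv A B C => exact ⟨_, .a A B C, by simp, by simp⟩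
  | l A => exact ⟨_, .lInv A, by simp, by simp⟩
  | lInv A => exact ⟨_, .l A, by simp, by simp⟩
  | r A => exact ⟨_, .rInv A, by simp, by simp⟩
  | rInv A => exact ⟨_, .r A, by simp, by simp⟩

/-- The right-nested, unit-free form of `A ⊗ X`, relative to `X`. -/
def flatten : Formula P J → Formula P J → Formula P J
  | .var p, X => .tensor (.var p) X
  | .unit, X => X
  | .tensor A B, X => flatten A (flatten B X)
  | .fn i A, X => .tensor (.fn i (flatten A .unit)) X

/-- The canonical isomorphism of `A ⊗ X` with its flattening. -/
def flattenIso : ∀ A X : Formula P J, A ⊗ X ≅ flatten A X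
  | .var p, X => Iso.refl ((Formula.var p : Formula P J) ⊗ X)
  | .unit, X => λ_ X
  | .tensor A B, X => α_ A B X ≪≫ whiskerLeftIso A (flattenIso B X) ≪≫ flattenIso A (flatten B X)
  | .fn i A, X => whiskerRightIso
      ((fnFunctor i).mapIso ((ρ_ A).symm ≪≫ flattenIso A (Formula.unit))) X

/-- The arrow `f` becomes an identity after flattening. -/
def Flat {A B : Formula P J} (f : A ⟶ B) : Prop :=
  ∀ X, ∃ e : flatten A X = flatten B X,
    (f ▷ X) ≫ (flattenIso B X).hom = (flattenIso A X).hom ≫ eqToHom e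

theorem Flat.inv {A B : Formula P J} {f : A ≅ B} (h : Flat f.hom) : Flat f.inv := by
  intro X
  obtain ⟨e, h⟩ := h X
  refine ⟨e.symm, ?_⟩
  have h1 := congrArg (fun z => (f.inv ▷ X) ≫ z ≫ eqToHom e.symm) h
  simp only [Category.assoc, eqToHom_trans, eqToHom_refl, Category.comp_id,
    inv_hom_whiskerRight_assoc] at h1
  exact h1.symm

theorem canonical_flat {A B : Formula P J} {f : A ⟶ B} (hf : Canonical f) : Flat f := by
  have ha : ∀ A B C : Formula P J, Flat (α_ A B C).hom := fun A B C X => ⟨rfl, by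
    change ((α_ A B C).hom ▷ X) ≫ (α_ A (B ⊗ C) X).hom ≫ (A ◁ ((α_ B C X).hom ≫
      (B ◁ (flattenIso C X).hom) ≫ (flattenIso B (flatten C X)).hom)) ≫
      (flattenIso A (flatten B (flatten C X))).hom =
      ((α_ (A ⊗ B) C X).hom ≫ ((A ⊗ B) ◁ (flattenIso C X).hom) ≫
      (α_ A B (flatten C X)).hom ≫ (A ◁ (flattenIso B (flatten C X)).hom) ≫
      (flattenIso A (flatten B (flatten C X))).hom) ≫ 𝟙 _
    simp⟩
  have hl : ∀ A : Formula P J, Flat (λ_ A).hom := fun A X => ⟨rfl, by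
    change ((λ_ A).hom ▷ X) ≫ (flattenIso A X).hom = ((α_ (𝟙_ _) A X).hom ≫
      (𝟙_ _ ◁ (flattenIso A X).hom) ≫ (λ_ (flatten A X)).hom) ≫ 𝟙 _
    simp⟩
  have hr : ∀ A : Formula P J, Flat (ρ_ A).hom := fun A X => ⟨rfl, by
    change ((ρ_ A).hom ▷ X) ≫ (flattenIso A X).hom = ((α_ A (𝟙_ _) X).hom ≫
      (A ◁ (λ_ X).hom) ≫ (flattenIso A X).hom) ≫ 𝟙 _
    simp⟩
  induction hf with
  | id A => exact fun X => ⟨rfl, by simp⟩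
  | @comp A B C f g _ _ ihf ihg =>
    intro X
    obtain ⟨e, h⟩ := ihf X
    obtain ⟨e', h'⟩ := ihg X
    refine ⟨e.trans e', ?_⟩
    rw [comp_whiskerRight, Category.assoc, h', ← Category.assoc, h, Category.assoc, eqToHom_trans]
  | @tensor A A' B B' f g _ _ ihf ihg =>
    intro X
    obtain ⟨e, h⟩ := ihg X
    obtain ⟨e', h'⟩ := ihf (flatten B' X)
    refine ⟨(congrArg (flatten A) e).trans e', ?_⟩
    change ((f ⊗ₘ g) ▷ X) ≫ (α_ A' B' X).hom ≫ (A' ◁ (flattenIso B' X).hom) ≫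
      (flattenIso A' (flatten B' X)).hom = ((α_ A B X).hom ≫ (A ◁ (flattenIso B X).hom) ≫
      (flattenIso A (flatten B X)).hom) ≫ eqToHom _
    have nat : ∀ {Y Z : Formula P J} (q : Y = Z), (flattenIso A Y).hom ≫
        eqToHom (congrArg (flatten A) q) = (A ◁ eqToHom q) ≫ (flattenIso A Z).hom := by
      rintro Y _ rfl; simp
    rw [← eqToHom_trans (congrArg (flatten A) e) e', Category.assoc, Category.assoc,
      ← Category.assoc (flattenIso A _).hom, nat e, Category.assoc, ← h',
      ← whiskerLeft_comp_assoc, ← h]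
    simp [MonoidalCategory.tensorHom_def', whisker_exchange_assoc]
  | @fn i A B f _ ih =>
    intro X
    obtain ⟨e, h⟩ := ih (𝟙_ _)
    have key : ∀ {Y Z : Formula P J} (q : Y = Z),
        ((fnFunctor i).map (eqToHom q)) ▷ X =
          eqToHom (congrArg (fun Y => Formula.tensor (Formula.fn i Y) X) q) := by
      rintro Y _ rfl
      rw [eqToHom_refl, CategoryTheory.Functor.map_id, id_whiskerRight]
      rfl
    refine ⟨congrArg (fun Y => Formula.tensor (Formula.fn i Y) X) e, ?_⟩
    have main : ((fnFunctor i).map f ▷ X) ≫ ((fnFunctor i).map ((ρ_ B).inv ≫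
        (flattenIso B (𝟙_ _)).hom) ▷ X) = ((fnFunctor i).map ((ρ_ A).inv ≫
        (flattenIso A (𝟙_ _)).hom) ▷ X) ≫ ((fnFunctor i).map (eqToHom e) ▷ X) := by
      rw [← comp_whiskerRight, ← comp_whiskerRight,
        ← CategoryTheory.Functor.map_comp, ← CategoryTheory.Functor.map_comp, Category.assoc, ← h,
        rightUnitor_inv_naturality_assoc]
    exact main.trans (congrArg (fun z => ((fnFunctor i).map ((ρ_ A).inv ≫
        (flattenIso A (𝟙_ _)).hom) ▷ X) ≫ z) (key e))
  | a A B C => exact ha A B C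
  | aInv A B C => exact (ha A B C).inv
  | l A => exact hl A
  | lInv A => exact (hl A).inv
  | r A => exact hr A
  | rInv A => exact (hr A).inv

/-- The canonical arrows form a groupoid and a preorder. -/
theorem canonical_isPreorderedGroupoid :
    IsPreorderedGroupoid (Canonical (P := P) (J := J)) where
  id_mem := Canonical.id
  comp_mem := Canonical.comp
  inv_mem _ hf := canonical_inv hf
  preorder {A B} f g hf hg := by
    obtain ⟨e, h⟩ := canonical_flat hf (𝟙_ _)
    obtain ⟨e', h'⟩ := canonical_flat hg (𝟙_ _)
    exact whiskerRight_iff f g |>.mp ((cancel_mono (flattenIso B (𝟙_ _)).hom).mp (h.trans h'.symm))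

/-- The strictification of the free symmetric monoidal category with a family of locally linear
endofunctors. -/
abbrev Strictification (P : Type u) (J : Type v) : Type (max u v) :=
  (canonical_isPreorderedGroupoid (P := P) (J := J)).Strict

/-- The functor `H` from the strictification. -/
noncomputable def H (P : Type u) (J : Type v) : Strictification P J ⥤ Formula P J :=
  canonical_isPreorderedGroupoid.fromStrict

end LocallyLinear

/-! ### Crossings and units in the middle-four interchange -/

section Symmetric

variable {C : Type u} [Category.{v} C] [MonoidalCategory.{v} C] [SymmetricCategory.{v} C]

/-! The proof is an induction on the target formula `B`: two arrows into `B` with the same graph are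
equal (`Determined`). Going by the target fits the direction of `psiL` and `psiR`. These arrows only
enlarge the scope of a functor, so whatever lies under an outermost generator of the source lands
under a single outermost generator of the target.

For a target `B ⊗ C`, colour the generators of `B` and of `C` differently. An arrow `f` pulls this
back to a colouring of the outermost generators of its source `A`. A colouring splits `A`, up to
isomorphism, into the tensor product of its two colour classes, and `f` becomes `f₁ ⊗ₘ f₂` between
the classes (`Coloring.exists_splits`). The graph of `f` determines the source colouring
(`Coloring.color_injective`), so two arrows with equal graphs are split along the same isomorphism.
Their components then have equal graphs too, and the induction hypotheses for `B` and `C` apply.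

For a target `Eⁱ B`, the head `Eⁱ` comes from an outermost occurrence of `Eⁱ` in the source. Pulling
that occurrence to the front by `psiL` and `psiR` factors the arrow as `x.pull ≫ fnMap i h`
(`Root.exists_pull`). The graph determines the occurrence `x` and the graph of `h`, and the
induction hypothesis for `B` gives `h`.

For a generator or the unit there is at most one generator in play. Every arrow is then canonical
(`canonical_arrow`), and canonical arrows form a preorder.

Faithfulness passes to the strictification because `H` is an equivalence. -/

/-- On the left only three pairs are crossed. On the right all four are, and the interchange then
crosses `X₁` and `Y₂` back; symmetry, as opposed to mere braiding, makes these two crossings cancel.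
-/
theorem tensorμ_comp_braiding_tensor_braiding (X₁ X₂ Y₁ Y₂ : C) :
    tensorμ X₁ X₂ Y₁ Y₂ ≫ ((β_ X₁ Y₁).hom ⊗ₘ (β_ X₂ Y₂).hom) =
      (β_ (X₁ ⊗ X₂) (Y₁ ⊗ Y₂)).hom ≫ tensorμ Y₁ Y₂ X₁ X₂ := by
  simp [tensorμ, SymmetricCategory.braiding_swap_eq_inv_braiding X₁ Y₂,
    MonoidalCategory.tensorHom_def]

/-- Splitting an object with an empty second part. -/
theorem rightUnitor_inv_tensorμ (X Y : C) :
    ((ρ_ X).inv ⊗ₘ (ρ_ Y).inv) ≫ tensorμ X (𝟙_ C) Y (𝟙_ C) =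
      (ρ_ (X ⊗ Y)).inv ≫ ((X ⊗ Y) ◁ (λ_ (𝟙_ C)).inv) := by
  have h := rightUnitor_monoidal X Y
  rw [← cancel_mono (((X ⊗ Y) ◁ (λ_ (𝟙_ C)).hom) ≫ (ρ_ (X ⊗ Y)).hom), Category.assoc, ← h]
  simp

/-- Splitting an object with an empty first part. -/
theorem leftUnitor_inv_tensorμ (X Y : C) :
    ((λ_ X).inv ⊗ₘ (λ_ Y).inv) ≫ tensorμ (𝟙_ C) X (𝟙_ C) Y =
      (λ_ (X ⊗ Y)).inv ≫ ((λ_ (𝟙_ C)).inv ▷ (X ⊗ Y)) := by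
  have h := leftUnitor_monoidal X Y
  rw [← cancel_mono (((λ_ (𝟙_ C)).hom ▷ (X ⊗ Y)) ≫ (λ_ (X ⊗ Y)).hom), Category.assoc, ← h]
  simp

end Symmetric

/-! ### The symmetry and the linearity of the endofunctors as arrows of the free category -/

namespace LocallyLinear

variable {P : Type u} {J : Type v}

theorem braid_natural {A A' B B' : Formula P J} (f : A ⟶ A') (g : B ⟶ B') :
    (f ⊗ₘ g) ≫ arrow (.c A' B') = arrow (.c A B) ≫ (g ⊗ₘ f) := by
  induction f using Quotient.ind
  induction g using Quotient.ind
  exact Quotient.sound (Rel.c_natural _ _)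

/-- The symmetry. -/
def braid (A B : Formula P J) : A ⊗ B ≅ B ⊗ A :=
  ⟨arrow (.c A B), arrow (.c B A), Quotient.sound (Rel.c_c A B), Quotient.sound (Rel.c_c B A)⟩

theorem braid_hexagon (A B C : Formula P J) :
    (α_ A B C).hom ≫ (braid A (B ⊗ C)).hom ≫ (α_ B C A).hom =
      ((braid A B).hom ▷ C) ≫ (α_ B A C).hom ≫ (B ◁ (braid A C).hom) :=
  Quotient.sound (Rel.hexagon A B C)

/-- The symmetric monoidal structure. -/
instance : SymmetricCategory (Formula P J) where
  braiding := braid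
  braiding_naturality_right A _ _ f := by
    have := braid_natural (𝟙 A) f
    rwa [id_tensorHom, tensorHom_id] at this
  braiding_naturality_left f A := by
    have := braid_natural f (𝟙 A)
    rwa [id_tensorHom, tensorHom_id] at this
  hexagon_forward := braid_hexagon
  hexagon_reverse A B C := by
    have h : (((braid C A).symm ≪≫ Iso.refl _).hom ▷ B) = ((braid A C).hom ▷ B) := by
      simp; rfl
    -- The reverse hexagon is the forward one for `C`, `A`, `B` with both sides inverted, since the
    -- inverse of `braid` is `braid` with its arguments exchanged.
    have e : ((α_ C A B) ≪≫ braid C (A ⊗ B) ≪≫ α_ A B C).inv =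
        (whiskerRightIso (braid C A) B ≪≫ α_ A C B ≪≫ whiskerLeftIso A (braid C B)).inv :=
      congrArg Iso.inv (Iso.ext (braid_hexagon C A B))
    simp only [Iso.trans_inv, Category.assoc, whiskerRightIso_inv, whiskerLeftIso_inv] at e
    exact e
  symmetry A B := (braid A B).hom_inv_id

theorem braiding_unit_hom (A : Formula P J) :
    (β_ A (𝟙_ (Formula P J))).hom = (ρ_ A).hom ≫ (λ_ A).inv := by simp

/-- The left linearity of the endofunctor `Eⁱ`. -/
def psiL (i : J) (A B : Formula P J) : Formula.fn i A ⊗ B ⟶ Formula.fn i (A ⊗ B) :=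
  arrow (.psiL i A B)

/-- The right linearity of the endofunctor `Eⁱ`. -/
def psiR (i : J) (A B : Formula P J) : A ⊗ Formula.fn i B ⟶ Formula.fn i (A ⊗ B) :=
  arrow (.psiR i A B)

section
variable (i : J) {A A' B B' C : Formula P J}

theorem fnMap_comp (f : A ⟶ B) (g : B ⟶ C) : fnMap i (f ≫ g) = fnMap i f ≫ fnMap i g :=
  (fnFunctor i).map_comp f g

theorem fnMap_id (A : Formula P J) : fnMap i (𝟙 A) = 𝟙 (Formula.fn i A) :=
  (fnFunctor i).map_id A

theorem psiL_natural (f : A ⟶ A') (g : B ⟶ B') :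
    (fnMap i f ⊗ₘ g) ≫ psiL i A' B' = psiL i A B ≫ fnMap i (f ⊗ₘ g) := by
  induction f using Quotient.ind
  induction g using Quotient.ind
  exact Quotient.sound (Rel.psiL_natural i _ _)

theorem psiR_natural (f : A ⟶ A') (g : B ⟶ B') :
    (f ⊗ₘ fnMap i g) ≫ psiR i A' B' = psiR i A B ≫ fnMap i (f ⊗ₘ g) := by
  induction f using Quotient.ind
  induction g using Quotient.ind
  exact Quotient.sound (Rel.psiR_natural i _ _)

variable (A B C)

theorem psiL_a : (psiL i A B ▷ C) ≫ psiL i (A ⊗ B) C ≫ fnMap i (α_ A B C).hom =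
    (α_ (Formula.fn i A) B C).hom ≫ psiL i A (B ⊗ C) :=
  Quotient.sound (Rel.psiL_a i A B C)

theorem psiL_r : psiL i A (𝟙_ _) ≫ fnMap i (ρ_ A).hom = (ρ_ (Formula.fn i A)).hom :=
  Quotient.sound (Rel.psiL_r i A)

theorem psiR_a : psiR i (A ⊗ B) C ≫ fnMap i (α_ A B C).hom =
    (α_ A B (Formula.fn i C)).hom ≫ (A ◁ psiR i B C) ≫ psiR i A (B ⊗ C) :=
  Quotient.sound (Rel.psiR_a i A B C)

theorem psiR_l : psiR i (𝟙_ _) A ≫ fnMap i (λ_ A).hom = (λ_ (Formula.fn i A)).hom :=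
  Quotient.sound (Rel.psiR_l i A)

theorem psiL_psiR_a : (psiR i A B ▷ C) ≫ psiL i (A ⊗ B) C ≫ fnMap i (α_ A B C).hom =
    (α_ A (Formula.fn i B) C).hom ≫ (A ◁ psiL i B C) ≫ psiR i A (B ⊗ C) :=
  Quotient.sound (Rel.psiL_psiR_a i A B C)

theorem psiL_psiR_c : psiL i A B ≫ fnMap i (β_ A B).hom = (β_ (Formula.fn i A) B).hom ≫ psiR i B A :=
  Quotient.sound (Rel.psiL_psiR_c i A B)

/-- The right linearity is the left one conjugated by the symmetry, so for splittings and for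
canonicity only `psiL` needs a direct argument. -/
theorem psiR_eq : psiR i A B = (β_ A (Formula.fn i B)).hom ≫ psiL i B A ≫ fnMap i (β_ B A).hom := by
  rw [psiL_psiR_c, SymmetricCategory.symmetry_assoc]

end

/-! ### Graphs are bijections -/

theorem juxt_bijective {m m' n n' : ℕ} {f : Fin m → Fin m'} {g : Fin n → Fin n'}
    (hf : Function.Bijective f) (hg : Function.Bijective g) :
    Function.Bijective (FinFun.juxt f g) := by
  constructor
  · intro x y
    induction x using Fin.addCases <;> induction y using Fin.addCases <;>
      simp only [FinFun.juxt_castAdd, FinFun.juxt_natAdd, Fin.ext_iff, Fin.val_castAdd,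
        Fin.val_natAdd] <;> intro h
    · rename_i i j
      exact congrArg Fin.val (hf.1 (Fin.ext h))
    · rename_i i j
      have := (f i).isLt
      omega
    · rename_i i j
      have := (f j).isLt
      omega
    · rename_i i j
      exact congrArg (m + Fin.val ·) (hg.1 (Fin.ext (Nat.add_left_cancel h)))
  · intro y
    induction y using Fin.addCases with
    | left j =>
      obtain ⟨i, rfl⟩ := hf.2 j
      exact ⟨Fin.castAdd _ i, FinFun.juxt_castAdd _ _ _⟩
    | right j =>
      obtain ⟨i, rfl⟩ := hg.2 j
      exact ⟨Fin.natAdd _ i, FinFun.juxt_natAdd _ _ _⟩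

theorem cast_bijective {m n : ℕ} (h : m = n) : Function.Bijective (Fin.cast h) := by
  subst h
  exact Function.bijective_id

theorem flip_flip (m n : ℕ) (x : Fin (m + n)) : FinFun.flip n m (FinFun.flip m n x) = x := by
  induction x using Fin.addCases <;> simp

theorem flip_bijective (m n : ℕ) : Function.Bijective (FinFun.flip m n) :=
  Function.bijective_iff_has_inverse.mpr ⟨FinFun.flip n m, flip_flip m n, flip_flip n m⟩

/-- Arrows neither create, delete nor merge generators. Hence source and target have equal size, an
occurrence in the target has only one preimage, and graphs can be cancelled on the left. -/
theorem graph_bijective {A B : Formula P J} (f : Term A B) : Function.Bijective (graph f) := by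
  induction f with
  | id => exact Function.bijective_id
  | comp f g ihf ihg => exact ihg.comp ihf
  | tensor f g ihf ihg => exact juxt_bijective ihf ihg
  | fn i f ih => exact juxt_bijective Function.bijective_id ih
  | c A B => exact flip_bijective _ _
  | psiR i A B =>
    exact ((cast_bijective (Nat.add_assoc 1 (size A) (size B))).comp
      (juxt_bijective (flip_bijective _ _) Function.bijective_id)).comp
        (cast_bijective (Nat.add_assoc (size A) 1 (size B)).symm)
  | a A B C => exact cast_bijective (Nat.add_assoc (size A) (size B) (size C))
  | aInv A B C => exact cast_bijective (Nat.add_assoc (size A) (size B) (size C)).symm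
  | l A => exact cast_bijective (Nat.zero_add (size A))
  | lInv A => exact cast_bijective (Nat.zero_add (size A)).symm
  | r A => exact cast_bijective (Nat.add_zero (size A))
  | rInv A => exact cast_bijective (Nat.add_zero (size A)).symm
  | psiL i A B => exact cast_bijective (Nat.add_assoc 1 (size A) (size B))

/-! ### Extraction of an outermost functor -/

/-- The outermost occurrences of `Eⁱ` in a formula. -/
inductive Root (i : J) : Formula P J → Type (max u v)
  | here (A : Formula P J) : Root i (.fn i A)
  | left {A : Formula P J} (x : Root i A) (B : Formula P J) : Root i (.tensor A B)
  | right (A : Formula P J) {B : Formula P J} (x : Root i B) : Root i (.tensor A B)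

namespace Root

variable {i : J}

/-- The formula that remains when the occurrence is deleted. -/
def rest : ∀ {A : Formula P J}, Root i A → Formula P J
  | _, .here A => A
  | _, .left x B => .tensor x.rest B
  | _, .right A x => .tensor A x.rest

/-- The position of the occurrence. -/
def pos : ∀ {A : Formula P J}, Root i A → Fin (size A)
  | _, .here A => Fin.castAdd (size A) (0 : Fin 1)
  | _, .left x B => Fin.castAdd (size B) x.pos
  | _, .right A x => Fin.natAdd (size A) x.pos

/-- The arrow that pulls the occurrence out to the front. -/
def pull : ∀ {A : Formula P J} (x : Root i A), A ⟶ Formula.fn i x.rest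
  | _, .here A => 𝟙 (Formula.fn i A)
  | _, .left x B => (x.pull ▷ B) ≫ psiL i x.rest B
  | _, .right A x => (A ◁ x.pull) ≫ psiR i A x.rest

theorem pos_injective : ∀ {A : Formula P J} (x y : Root i A), x.pos = y.pos → x = y
  | _, .here A, .here _, _ => rfl
  | _, .left x B, .left y _, h =>
    congrArg (Root.left · B) (pos_injective x y (Fin.castAdd_injective _ _ h))
  | _, .right A x, .right _ y, h =>
    congrArg (Root.right A) (pos_injective x y (Fin.natAdd_injective _ _ h))
  | _, .left x _, .right _ y, h => by
    have h1 := congrArg Fin.val h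
    have h2 := x.pos.isLt
    simp only [pos, Fin.val_castAdd, Fin.val_natAdd] at h1
    omega
  | _, .right _ x, .left y _, h => by
    have h1 := congrArg Fin.val h
    have h2 := y.pos.isLt
    simp only [pos, Fin.val_castAdd, Fin.val_natAdd] at h1
    omega

/-- The square for an isomorphism yields the one for its inverse, so each structural isomorphism is
treated in one direction only. -/
theorem pull_inv {A B : Formula P J} (e : A ≅ B) (x : Root i A) (y : Root i B)
    (h : x.rest ≅ y.rest) (w : e.hom ≫ y.pull = x.pull ≫ fnMap i h.hom) :
    e.inv ≫ x.pull = y.pull ≫ fnMap i h.inv := by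
  rw [Iso.inv_comp_eq, ← Category.assoc, w, Category.assoc, ← fnMap_comp, Iso.hom_inv_id,
    fnMap_id, Category.comp_id]

section
variable {A A' : Formula P J} (d : A ⟶ Formula.fn i A') (B C : Formula P J)

/-- Pulling out commutes with the associator. This lemma and the next two treat the occurrence in
the first, middle and last factor; each is one associativity equation of a locally linear functor
combined with naturality of the associator. The arrow `d` stands for the pull inside the factor. -/
theorem associator_hom_psiL : (α_ A B C).hom ≫ (d ▷ (B ⊗ C)) ≫ psiL i A' (B ⊗ C) =
    ((((d ▷ B) ≫ psiL i A' B) ▷ C) ≫ psiL i (A' ⊗ B) C) ≫ fnMap i (α_ A' B C).hom := by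
  rw [comp_whiskerRight, Category.assoc, Category.assoc, psiL_a]
  simp

theorem associator_hom_psiL_psiR : (α_ B A C).hom ≫ (B ◁ ((d ▷ C) ≫ psiL i A' C)) ≫
      psiR i B (A' ⊗ C) =
    ((((B ◁ d) ≫ psiR i B A') ▷ C) ≫ psiL i (B ⊗ A') C) ≫ fnMap i (α_ B A' C).hom := by
  rw [comp_whiskerRight, Category.assoc, Category.assoc, psiL_psiR_a]
  simp

theorem associator_hom_psiR : (α_ B C A).hom ≫ (B ◁ ((C ◁ d) ≫ psiR i C A')) ≫
      psiR i B (C ⊗ A') =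
    (((B ⊗ C) ◁ d) ≫ psiR i (B ⊗ C) A') ≫ fnMap i (α_ B C A').hom := by
  rw [Category.assoc, psiR_a]
  simp

theorem leftUnitor_hom_psiR :
    (λ_ A).hom ≫ d = ((𝟙_ _ ◁ d) ≫ psiR i (𝟙_ _) A') ≫ fnMap i (λ_ A').hom := by
  rw [Category.assoc, psiR_l, leftUnitor_naturality]

theorem rightUnitor_hom_psiL :
    (ρ_ A).hom ≫ d = ((d ▷ 𝟙_ _) ≫ psiL i A' (𝟙_ _)) ≫ fnMap i (ρ_ A').hom := by
  rw [Category.assoc, psiL_r, rightUnitor_naturality]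

theorem braiding_hom_psiR :
    (β_ A B).hom ≫ (B ◁ d) ≫ psiR i B A' = ((d ▷ B) ≫ psiL i A' B) ≫ fnMap i (β_ A' B).hom := by
  rw [Category.assoc, psiL_psiR_c, BraidedCategory.braiding_naturality_left_assoc]

end

/-- An arrow carries an outermost `Eⁱ` of the target back to one of the source, and commutes with
pulling these out. -/
theorem exists_pull {A B : Formula P J} (f : Term A B) (y : Root i B) :
    ∃ x : Root i A, graph f x.pos = y.pos ∧
      ∃ h : x.rest ⟶ y.rest, arrow f ≫ y.pull = x.pull ≫ fnMap i h := by
  induction f with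
  | id A => exact ⟨y, rfl, 𝟙 _, by
      rw [fnMap_id, Category.comp_id]; exact Category.id_comp _⟩
  | comp f g ihf ihg =>
    obtain ⟨z, hz, k, ek⟩ := ihg y
    obtain ⟨x, hx, h, eh⟩ := ihf z
    refine ⟨x, (congrArg (graph g) hx).trans hz, h ≫ k, ?_⟩
    change (arrow f ≫ arrow g) ≫ _ = _
    rw [Category.assoc, ek, ← Category.assoc, eh, Category.assoc, fnMap_comp]
  | @tensor A A' B B' f g ihf ihg =>
    cases y with
    | left y _ =>
      obtain ⟨x, hx, h, eh⟩ := ihf y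
      refine ⟨.left x B, ?_, h ⊗ₘ arrow g, ?_⟩
      · simp only [graph, pos, FinFun.juxt_castAdd]
        exact congrArg _ hx
      · change (arrow f ⊗ₘ arrow g) ≫ (y.pull ▷ B') ≫ psiL i y.rest B' =
          ((x.pull ▷ B) ≫ psiL i x.rest B) ≫ fnMap i (h ⊗ₘ arrow g)
        rw [Category.assoc, ← psiL_natural, ← Category.assoc, ← Category.assoc]
        congr 1
        rw [← tensorHom_id, ← tensorHom_id, tensorHom_comp_tensorHom, tensorHom_comp_tensorHom, eh,
          Category.id_comp, Category.comp_id]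
    | right _ y =>
      obtain ⟨x, hx, h, eh⟩ := ihg y
      refine ⟨.right A x, ?_, arrow f ⊗ₘ h, ?_⟩
      · simp only [graph, pos, FinFun.juxt_natAdd]
        exact congrArg _ hx
      · change (arrow f ⊗ₘ arrow g) ≫ (A' ◁ y.pull) ≫ psiR i A' y.rest =
          ((A ◁ x.pull) ≫ psiR i A x.rest) ≫ fnMap i (arrow f ⊗ₘ h)
        rw [Category.assoc, ← psiR_natural, ← Category.assoc, ← Category.assoc]
        congr 1
        rw [← id_tensorHom, ← id_tensorHom, tensorHom_comp_tensorHom, tensorHom_comp_tensorHom, eh,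
          Category.id_comp, Category.comp_id]
  | fn j f ih =>
    -- The head is the only outermost occurrence in a formula `Eʲ B`, so `j = i` and the residual
    -- arrow is `f` itself.
    cases y
    exact ⟨.here _, FinFun.juxt_castAdd _ _ _, arrow f,
      (Category.comp_id _).trans (Category.id_comp _).symm⟩
  | a A B C =>
    cases y with
    | left x _ => exact ⟨.left (.left x B) C, rfl, _, associator_hom_psiL x.pull B C⟩
    | right _ y =>
      cases y with
      | left x _ => exact ⟨.left (.right A x) C, rfl, _, associator_hom_psiL_psiR x.pull A C⟩
      | right _ x => exact
          ⟨.right (.tensor A B) x, FinFun.assoc_three _, _, associator_hom_psiR x.pull A B⟩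
  | aInv A B C =>
    cases y with
    | right _ x =>
      exact ⟨.right A (.right B x), FinFun.assocInv_three _, _,
        pull_inv (α_ A B C) (.right (.tensor A B) x) (.right A (.right B x)) (α_ A B x.rest)
          (associator_hom_psiR x.pull A B)⟩
    | left y _ =>
      cases y with
      | left x _ => exact ⟨.left x (.tensor B C), rfl, _,
          pull_inv (α_ A B C) (.left (.left x B) C) (.left x (.tensor B C)) (α_ x.rest B C)
            (associator_hom_psiL x.pull B C)⟩
      | right _ x => exact ⟨.right A (.left x C), rfl, _,
          pull_inv (α_ A B C) (.left (.right A x) C) (.right A (.left x C)) (α_ A x.rest C)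
            (associator_hom_psiL_psiR x.pull A C)⟩
  | l A => exact ⟨.right .unit y, FinFun.left_natAdd _, _, leftUnitor_hom_psiR y.pull⟩
  | lInv A =>
    cases y with
    | left y _ => cases y
    | right _ x => exact
        ⟨x, FinFun.leftInv_eq _, _, pull_inv (λ_ A) (.right .unit x) x (λ_ x.rest)
          (leftUnitor_hom_psiR x.pull)⟩
  | r A => exact ⟨.left y .unit, rfl, _, rightUnitor_hom_psiL y.pull⟩
  | rInv A =>
    cases y with
    | right _ y => cases y
    | left x _ => exact
        ⟨x, rfl, _, pull_inv (ρ_ A) (.left x .unit) x (ρ_ x.rest) (rightUnitor_hom_psiL x.pull)⟩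
  | c A B =>
    cases y with
    -- The crossing of `A` with `B` is by definition the inverse of the crossing of `B` with `A`, so
    -- this case is the other one inverted.
    | left y _ => exact ⟨.right A y, FinFun.flip_natAdd _, _,
        pull_inv (β_ B A) (.left y A) (.right A y) (β_ y.rest A) (braiding_hom_psiR y.pull A)⟩
    | right _ y => exact ⟨.left y B, FinFun.flip_castAdd _, _, braiding_hom_psiR y.pull B⟩
  | psiL j A B =>
    cases y
    -- Here the term itself is the pull of the occurrence, so nothing remains for the residual
    -- arrow.
    refine ⟨.left (.here A) B, rfl, 𝟙 _, ?_⟩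
    change psiL i A B ≫ 𝟙 _ = ((𝟙 (Formula.fn i A) ▷ B) ≫ psiL i A B) ≫ fnMap i (𝟙 (A ⊗ B))
    rw [id_whiskerRight, fnMap_id, Category.id_comp]
  | psiR j A B =>
    cases y
    refine ⟨.right A (.here B), FinFun.toFront_two _, 𝟙 _, ?_⟩
    change psiR i A B ≫ 𝟙 _ = ((A ◁ 𝟙 (Formula.fn i B)) ≫ psiR i A B) ≫ fnMap i (𝟙 (A ⊗ B))
    rw [whiskerLeft_id, fnMap_id, Category.id_comp]

end Root

end LocallyLinear

/-! ### Structural isomorphisms and the middle-four interchange -/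

section Symmetric

variable {C : Type u} [Category.{v} C] [MonoidalCategory.{v} C] [SymmetricCategory.{v} C]

/-- The middle-four interchange as an isomorphism. -/
def tensorμIso (X₁ X₂ Y₁ Y₂ : C) : (X₁ ⊗ X₂) ⊗ Y₁ ⊗ Y₂ ≅ (X₁ ⊗ Y₁) ⊗ X₂ ⊗ Y₂ where
  hom := tensorμ X₁ X₂ Y₁ Y₂
  inv := tensorδ X₁ X₂ Y₁ Y₂

variable {X Y Z X₁ X₂ Y₁ Y₂ Z₁ Z₂ : C} (f : X ⟶ X₁ ⊗ X₂) (g : Y ⟶ Y₁ ⊗ Y₂) (h : Z ⟶ Z₁ ⊗ Z₂)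

/-- Coherence of the interchange with the associator, precomposed with arbitrary `f`, `g`, `h`.
These will be the splittings of the three factors; the form is the one that `Coloring.splits_iso`
takes as input. -/
theorem associator_hom_tensorμ :
    (α_ X Y Z).hom ≫ (f ⊗ₘ ((g ⊗ₘ h) ≫ tensorμ Y₁ Y₂ Z₁ Z₂)) ≫
        tensorμ X₁ X₂ (Y₁ ⊗ Z₁) (Y₂ ⊗ Z₂) =
      ((((f ⊗ₘ g) ≫ tensorμ X₁ X₂ Y₁ Y₂) ⊗ₘ h) ≫ tensorμ (X₁ ⊗ Y₁) (X₂ ⊗ Y₂) Z₁ Z₂) ≫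
        ((α_ X₁ Y₁ Z₁).hom ⊗ₘ (α_ X₂ Y₂ Z₂).hom) := by
  have e1 : (f ⊗ₘ ((g ⊗ₘ h) ≫ tensorμ Y₁ Y₂ Z₁ Z₂)) =
      (f ⊗ₘ (g ⊗ₘ h)) ≫ ((X₁ ⊗ X₂) ◁ tensorμ Y₁ Y₂ Z₁ Z₂) := by
    rw [← id_tensorHom, tensorHom_comp_tensorHom, Category.comp_id]
  have e2 : (((f ⊗ₘ g) ≫ tensorμ X₁ X₂ Y₁ Y₂) ⊗ₘ h) =
      ((f ⊗ₘ g) ⊗ₘ h) ≫ (tensorμ X₁ X₂ Y₁ Y₂ ▷ (Z₁ ⊗ Z₂)) := by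
    rw [← tensorHom_id, tensorHom_comp_tensorHom, Category.comp_id]
  rw [e1, e2, Category.assoc, Category.assoc, Category.assoc, tensor_associativity,
    associator_naturality_assoc]

theorem leftUnitor_hom_tensorμ :
    (λ_ X).hom ≫ f = (((λ_ (𝟙_ C)).inv ⊗ₘ f) ≫ tensorμ (𝟙_ C) (𝟙_ C) X₁ X₂) ≫
      ((λ_ X₁).hom ⊗ₘ (λ_ X₂).hom) := by
  rw [← leftUnitor_naturality, tensor_left_unitality,
    MonoidalCategory.tensorHom_def' (λ_ (𝟙_ C)).inv f]
  simp only [Category.assoc]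

theorem rightUnitor_hom_tensorμ :
    (ρ_ X).hom ≫ f = ((f ⊗ₘ (λ_ (𝟙_ C)).inv) ≫ tensorμ X₁ X₂ (𝟙_ C) (𝟙_ C)) ≫
      ((ρ_ X₁).hom ⊗ₘ (ρ_ X₂).hom) := by
  rw [← rightUnitor_naturality, tensor_right_unitality,
    MonoidalCategory.tensorHom_def f (λ_ (𝟙_ C)).inv]
  simp only [Category.assoc]

theorem braiding_hom_tensorμ :
    (β_ X Y).hom ≫ (g ⊗ₘ f) ≫ tensorμ Y₁ Y₂ X₁ X₂ = ((f ⊗ₘ g) ≫ tensorμ X₁ X₂ Y₁ Y₂) ≫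
      ((β_ X₁ Y₁).hom ⊗ₘ (β_ X₂ Y₂).hom) := by
  rw [Category.assoc, tensorμ_comp_braiding_tensor_braiding,
    BraidedCategory.braiding_naturality_assoc]

end Symmetric

/-! ### Colourings and the splitting of a formula into two colour classes -/

namespace LocallyLinear

variable {P : Type u} {J : Type v}

/-- A formula is kept or replaced by the unit. -/
def keep : Bool → Formula P J → Formula P J
  | true, A => A
  | false, _ => .unit

/-- The canonical splitting with one trivial part. -/
def splitKeep : ∀ (b : Bool) (A : Formula P J), A ≅ keep b A ⊗ keep (!b) A
  | true, A => (ρ_ A).symm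
  | false, A => (λ_ A).symm

/-- When one part is the unit, `f` acts on the other part and the identity on the unit; this is
naturality of a unitor. -/
theorem splitKeep_natural (b : Bool) {A B : Formula P J} (f : A ⟶ B) :
    ∃ (f₁ : keep b A ⟶ keep b B) (f₂ : keep (!b) A ⟶ keep (!b) B),
      f ≫ (splitKeep b B).hom = (splitKeep b A).hom ≫ (f₁ ⊗ₘ f₂) := by
  cases b
  · exact ⟨𝟙 _, f, (leftUnitor_inv_naturality f).trans
      (congrArg ((λ_ A).inv ≫ ·) (id_tensorHom _ f).symm)⟩
  · exact ⟨f, 𝟙 _, (rightUnitor_inv_naturality f).trans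
      (congrArg ((ρ_ A).inv ≫ ·) (tensorHom_id f _).symm)⟩

theorem splitKeep_tensor (b : Bool) (A B : Formula P J) :
    ∃ (m₁ : keep b (A ⊗ B) ≅ keep b A ⊗ keep b B)
      (m₂ : keep (!b) (A ⊗ B) ≅ keep (!b) A ⊗ keep (!b) B),
      ((splitKeep b A).hom ⊗ₘ (splitKeep b B).hom) ≫ tensorμ _ _ _ _ =
        (splitKeep b (A ⊗ B)).hom ≫ (m₁.hom ⊗ₘ m₂.hom) := by
  cases b
  · exact ⟨(λ_ (𝟙_ _)).symm, Iso.refl (A ⊗ B), (leftUnitor_inv_tensorμ A B).trans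
      (congrArg ((λ_ (A ⊗ B)).inv ≫ ·) (tensorHom_id _ (A ⊗ B)).symm)⟩
  · exact ⟨Iso.refl (A ⊗ B), (λ_ (𝟙_ _)).symm, (rightUnitor_inv_tensorμ A B).trans
      (congrArg ((ρ_ (A ⊗ B)).inv ≫ ·) (id_tensorHom (A ⊗ B) _).symm)⟩

/-- A colouring of the outermost occurrences of generators in a formula. -/
inductive Coloring : Formula P J → Type (max u v)
  | var (p : P) (b : Bool) : Coloring (.var p)
  | unit : Coloring .unit
  | tensor {A B : Formula P J} (S : Coloring A) (T : Coloring B) : Coloring (.tensor A B)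
  | fn (i : J) (A : Formula P J) (b : Bool) : Coloring (.fn i A)

namespace Coloring

/-- The opposite colouring. -/
def neg : ∀ {A : Formula P J}, Coloring A → Coloring A
  | _, .var p b => .var p !b
  | _, .unit => .unit
  | _, .tensor S T => .tensor S.neg T.neg
  | _, .fn i A b => .fn i A !b

/-- The part of the formula with colour `true`. -/
def restrict : ∀ {A : Formula P J}, Coloring A → Formula P J
  | _, .var p b => keep b (.var p)
  | _, .unit => .unit
  | _, .tensor S T => .tensor S.restrict T.restrict
  | _, .fn i A b => keep b (.fn i A)

/-- The colour of an occurrence is that of the outermost occurrence above it. -/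
def color : ∀ {A : Formula P J}, Coloring A → Fin (size A) → Bool
  | _, .var _ b => fun _ => b
  | _, .unit => fun _ => true
  | _, .tensor S T => Fin.addCases S.color T.color
  | _, .fn _ _ b => fun _ => b

/-- The splitting of a formula into its two colour classes. -/
def split : ∀ {A : Formula P J} (T : Coloring A), A ≅ T.restrict ⊗ T.neg.restrict
  | _, .var p b => splitKeep b (.var p)
  | _, .unit => (λ_ (𝟙_ (Formula P J))).symm
  | _, .tensor S T => tensorIso S.split T.split ≪≫ tensorμIso _ _ _ _
  | _, .fn i A b => splitKeep b (.fn i A)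

theorem color_castAdd {A B : Formula P J} (S : Coloring A) (T : Coloring B)
    (x : Fin (size A)) : (S.tensor T).color (Fin.castAdd (size B) x) = S.color x := by
  simp [color]

theorem color_natAdd {A B : Formula P J} (S : Coloring A) (T : Coloring B)
    (x : Fin (size B)) : (S.tensor T).color (Fin.natAdd (size A) x) = T.color x := by
  simp [color]

/-- Each coloured node occupies at least one position, where its colour can be read, and the unit
carries no choice. Hence a graph determines the colouring pulled back along it. -/
theorem color_injective : ∀ {A : Formula P J} (S T : Coloring A), S.color = T.color → S = T
  | _, .var p _, .var _ _, h => congrArg (Coloring.var p) (congrFun h (0 : Fin 1))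
  | _, .unit, .unit, _ => rfl
  | _, .tensor S S', .tensor T T', h => by
    have h1 : S.color = T.color := funext fun x => by
      simpa [color] using congrFun h (Fin.castAdd _ x)
    have h2 : S'.color = T'.color := funext fun x => by
      simpa [color] using congrFun h (Fin.natAdd _ x)
    rw [color_injective S T h1, color_injective S' T' h2]
  | _, .fn i A _, .fn _ _ _, h =>
    congrArg (Coloring.fn i A) (congrFun h (Fin.castAdd (size A) (0 : Fin 1)))

/-- The colouring with only one colour. -/
def const (b : Bool) : ∀ A : Formula P J, Coloring A
  | .var p => .var p b
  | .unit => .unit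
  | .tensor A B => .tensor (const b A) (const b B)
  | .fn i A => .fn i A b

theorem color_const (b : Bool) : ∀ (A : Formula P J) (x : Fin (size A)), (const b A).color x = b
  | .var _, _ => rfl
  | .unit, x => x.elim0
  | .tensor A B, x => by
    induction x using Fin.addCases with
    | left x => exact (color_castAdd _ _ x).trans (color_const b A x)
    | right x => exact (color_natAdd _ _ x).trans (color_const b B x)
  | .fn _ _, _ => rfl

/-- The parts of a formula coloured with one colour only. -/
theorem exists_split_const (b : Bool) : ∀ A : Formula P J,
    ∃ (e₁ : keep b A ≅ (const b A).restrict) (e₂ : keep (!b) A ≅ (const b A).neg.restrict),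
      (const b A).split.hom = (splitKeep b A).hom ≫ (e₁.hom ⊗ₘ e₂.hom)
  | .var p => ⟨Iso.refl _, Iso.refl _,
      ((congrArg (_ ≫ ·) (id_tensorHom_id _ _)).trans (Category.comp_id _)).symm⟩
  | .fn i A => ⟨Iso.refl _, Iso.refl _,
      ((congrArg (_ ≫ ·) (id_tensorHom_id _ _)).trans (Category.comp_id _)).symm⟩
  | .unit => by
    have h := (congrArg ((λ_ (𝟙_ (Formula P J))).inv ≫ ·) (id_tensorHom_id _ _)).trans
      (Category.comp_id _)
    -- The unit is always split by its left unitor, whereas `splitKeep true` uses the right one; the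
    -- two agree on the unit object.
    cases b <;> refine ⟨Iso.refl (𝟙_ _), Iso.refl (𝟙_ _), ?_⟩
    · exact h.symm
    · exact h.symm.trans (congrArg (· ≫ _) unitors_inv_equal)
  | .tensor A B => by
    obtain ⟨d₁, d₂, hd⟩ := exists_split_const b A
    obtain ⟨e₁, e₂, he⟩ := exists_split_const b B
    obtain ⟨m₁, m₂, hm⟩ := splitKeep_tensor b A B
    refine ⟨m₁ ≪≫ tensorIso d₁ e₁, m₂ ≪≫ tensorIso d₂ e₂, ?_⟩
    change ((const b A).split.hom ⊗ₘ (const b B).split.hom) ≫ tensorμ _ _ _ _ =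
      (splitKeep b (A ⊗ B)).hom ≫ ((m₁.hom ≫ (d₁.hom ⊗ₘ e₁.hom)) ⊗ₘ (m₂.hom ≫ (d₂.hom ⊗ₘ e₂.hom)))
    rw [hd, he, ← tensorHom_comp_tensorHom, ← tensorHom_comp_tensorHom, Category.assoc,
      tensorμ_natural, ← Category.assoc, hm, Category.assoc]

/-! ### Arrows respect the splittings -/

/-- The arrow is compatible with the splittings of its source and target. -/
def Splits {A B : Formula P J} (f : A ⟶ B) (S : Coloring A) (T : Coloring B) : Prop :=
  ∃ (f₁ : S.restrict ⟶ T.restrict) (f₂ : S.neg.restrict ⟶ T.neg.restrict),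
    f ≫ T.split.hom = S.split.hom ≫ (f₁ ⊗ₘ f₂)

theorem splits_id {A : Formula P J} (S : Coloring A) : Splits (𝟙 A) S S :=
  ⟨𝟙 _, 𝟙 _, by simp⟩

theorem Splits.comp {A B C : Formula P J} {f : A ⟶ B} {g : B ⟶ C} {R : Coloring A} {S : Coloring B}
    {T : Coloring C} (hf : Splits f R S) (hg : Splits g S T) : Splits (f ≫ g) R T := by
  obtain ⟨f₁, f₂, h⟩ := hf
  obtain ⟨g₁, g₂, k⟩ := hg
  refine ⟨f₁ ≫ g₁, f₂ ≫ g₂, ?_⟩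
  rw [Category.assoc, k, ← Category.assoc, h, Category.assoc, tensorHom_comp_tensorHom]

theorem Splits.tensor {A A' B B' : Formula P J} {f : A ⟶ A'} {g : B ⟶ B'} {S : Coloring A}
    {S' : Coloring A'} {T : Coloring B} {T' : Coloring B'} (hf : Splits f S S')
    (hg : Splits g T T') : Splits (f ⊗ₘ g) (S.tensor T) (S'.tensor T') := by
  obtain ⟨f₁, f₂, h⟩ := hf
  obtain ⟨g₁, g₂, k⟩ := hg
  refine ⟨f₁ ⊗ₘ g₁, f₂ ⊗ₘ g₂, ?_⟩
  change (f ⊗ₘ g) ≫ (S'.split.hom ⊗ₘ T'.split.hom) ≫ tensorμ _ _ _ _ =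
    ((S.split.hom ⊗ₘ T.split.hom) ≫ tensorμ _ _ _ _) ≫ ((f₁ ⊗ₘ g₁) ⊗ₘ (f₂ ⊗ₘ g₂))
  rw [Category.assoc, ← tensorμ_natural, ← Category.assoc, ← Category.assoc,
    tensorHom_comp_tensorHom, tensorHom_comp_tensorHom, h, k]

/-- Everything under an outermost functor has a single colour, so the splitting only adds a unit and
imposes nothing on `f`. -/
theorem splits_fn (i : J) (b : Bool) {A B : Formula P J} (f : Formula.fn i A ⟶ Formula.fn i B) :
    Splits f (.fn i A b) (.fn i B b) :=
  splitKeep_natural b f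

/-- After `psiL` all of `B` stands under `Eⁱ`, so the source must be wholly of colour `b`. Both
splittings are then trivial up to isomorphism, and the claim reduces to naturality of `splitKeep`.
-/
theorem splits_psiL (i : J) (b : Bool) (A B : Formula P J) :
    Splits (psiL i A B) (.tensor (.fn i A b) (const b B)) (.fn i (A ⊗ B) b) := by
  obtain ⟨e₁, e₂, he⟩ := exists_split_const b B
  obtain ⟨m₁, m₂, hm⟩ := splitKeep_tensor b (Formula.fn i A) B
  obtain ⟨f₁, f₂, hf⟩ := splitKeep_natural b (psiL i A B)
  -- The components first undo the node-by-node splitting of `B` (`e₁`, `e₂`), then merge the two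
  -- factors into one kept formula (`m₁`, `m₂`), and only then apply the components of `psiL`.
  refine ⟨(keep b (Formula.fn i A) ◁ e₁.inv) ≫ m₁.inv ≫ f₁,
    (keep (!b) (Formula.fn i A) ◁ e₂.inv) ≫ m₂.inv ≫ f₂, ?_⟩
  change psiL i A B ≫ (splitKeep b (Formula.fn i (A ⊗ B))).hom =
    (((splitKeep b (Formula.fn i A)).hom ⊗ₘ (const b B).split.hom) ≫ tensorμ _ _ _ _) ≫ _
  have h1 : ((splitKeep b (Formula.fn i A)).hom ⊗ₘ (const b B).split.hom) =
      ((splitKeep b (Formula.fn i A)).hom ⊗ₘ (splitKeep b B).hom) ≫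
        ((𝟙 _ ⊗ₘ 𝟙 _) ⊗ₘ (e₁.hom ⊗ₘ e₂.hom)) := by
    rw [he, tensorHom_comp_tensorHom, id_tensorHom_id, Category.comp_id]
  have h2 : ((m₁.hom ⊗ₘ m₂.hom) ≫ ((𝟙 _ ⊗ₘ e₁.hom) ⊗ₘ (𝟙 _ ⊗ₘ e₂.hom))) ≫
      (((keep b (Formula.fn i A) ◁ e₁.inv) ≫ m₁.inv ≫ f₁) ⊗ₘ
        ((keep (!b) (Formula.fn i A) ◁ e₂.inv) ≫ m₂.inv ≫ f₂)) = f₁ ⊗ₘ f₂ := by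
    simp [tensorHom_comp_tensorHom]
  rw [h1, Category.assoc, tensorμ_natural, ← Category.assoc, hm, hf, ← h2]
  exact (Category.assoc _ _ _).symm.trans (congrArg (· ≫ _) (Category.assoc _ _ _).symm)

theorem splits_iso {A B : Formula P J} (e : A ≅ B) {S : Coloring A} {T : Coloring B}
    (e₁ : S.restrict ≅ T.restrict) (e₂ : S.neg.restrict ≅ T.neg.restrict)
    (h : e.hom ≫ T.split.hom = S.split.hom ≫ (e₁.hom ⊗ₘ e₂.hom)) :
    Splits e.hom S T ∧ Splits e.inv T S := by
  refine ⟨⟨_, _, h⟩, e₁.inv, e₂.inv, ?_⟩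
  rw [Iso.inv_comp_eq, ← Category.assoc, h, Category.assoc, tensorHom_comp_tensorHom]
  simp

theorem splits_a {A B C : Formula P J} (R : Coloring A) (S : Coloring B) (T : Coloring C) :
    Splits (α_ A B C).hom (.tensor (.tensor R S) T) (.tensor R (.tensor S T)) ∧
      Splits (α_ A B C).inv (.tensor R (.tensor S T)) (.tensor (.tensor R S) T) :=
  splits_iso (α_ A B C) (S := .tensor (.tensor R S) T) (T := .tensor R (.tensor S T))
    (α_ R.restrict S.restrict T.restrict) (α_ R.neg.restrict S.neg.restrict T.neg.restrict)
    (associator_hom_tensorμ R.split.hom S.split.hom T.split.hom)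

theorem splits_l {A : Formula P J} (T : Coloring A) :
    Splits (λ_ A).hom (.tensor .unit T) T ∧ Splits (λ_ A).inv T (.tensor .unit T) :=
  splits_iso (λ_ A) (S := .tensor .unit T) (λ_ T.restrict) (λ_ T.neg.restrict)
    (leftUnitor_hom_tensorμ T.split.hom)

theorem splits_r {A : Formula P J} (T : Coloring A) :
    Splits (ρ_ A).hom (.tensor T .unit) T ∧ Splits (ρ_ A).inv T (.tensor T .unit) :=
  splits_iso (ρ_ A) (S := .tensor T .unit) (ρ_ T.restrict) (ρ_ T.neg.restrict)
    (rightUnitor_hom_tensorμ T.split.hom)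

theorem splits_c {A B : Formula P J} (S : Coloring A) (T : Coloring B) :
    Splits (β_ A B).hom (.tensor S T) (.tensor T S) :=
  ⟨(β_ S.restrict T.restrict).hom, (β_ S.neg.restrict T.neg.restrict).hom,
    braiding_hom_tensorμ S.split.hom T.split.hom⟩

theorem splits_psiR (i : J) (b : Bool) (A B : Formula P J) :
    Splits (psiR i A B) (.tensor (const b A) (.fn i B b)) (.fn i (A ⊗ B) b) := by
  rw [psiR_eq]
  exact (splits_c _ _).comp ((splits_psiL i b B A).comp (splits_fn i b _))

open FinFun in
/-- An arrow carries a colouring of its target back to one of its source, and is compatible with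
the splittings. -/
theorem exists_splits {A B : Formula P J} (f : Term A B) (T : Coloring B) :
    ∃ S : Coloring A, (∀ x, S.color x = T.color (graph f x)) ∧ Splits (arrow f) S T := by
  induction f with
  | id A => exact ⟨T, fun _ => rfl, splits_id T⟩
  | comp f g ihf ihg =>
    obtain ⟨S, hS, k⟩ := ihg T
    obtain ⟨R, hR, h⟩ := ihf S
    exact ⟨R, fun x => (hR x).trans (hS _), h.comp k⟩
  | tensor f g ihf ihg =>
    cases T with
    | tensor T T' =>
      obtain ⟨S, hS, h⟩ := ihf T
      obtain ⟨S', hS', h'⟩ := ihg T'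
      refine ⟨.tensor S S', forall_add.mpr ⟨fun x => ?_, fun x => ?_⟩, h.tensor h'⟩
      · simp only [graph, color_castAdd, juxt_castAdd, hS]
      · simp only [graph, color_natAdd, juxt_natAdd, hS']
  | fn i f ih =>
    cases T with
    | fn _ _ b => exact ⟨.fn i _ b, fun _ => rfl, splits_fn i b _⟩
  | a A B C =>
    cases T with
    | tensor R T =>
      cases T with
      | tensor S T =>
        refine ⟨.tensor (.tensor R S) T, forall_add.mpr ⟨forall_add.mpr ⟨fun x => ?_, fun x => ?_⟩,
          fun x => ?_⟩, (splits_a R S T).1⟩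
        · exact ((color_castAdd (.tensor R S) T _).trans (color_castAdd R S x)).trans
            (color_castAdd R (.tensor S T) x).symm
        · exact ((color_castAdd (.tensor R S) T _).trans (color_natAdd R S x)).trans
            ((color_natAdd R (.tensor S T) _).trans (color_castAdd S T x)).symm
        · exact (color_natAdd (.tensor R S) T x).trans (((color_natAdd R (.tensor S T) _).trans
            (color_natAdd S T x)).symm.trans (congrArg _ (assoc_three x).symm))
  | aInv A B C =>
    cases T with
    | tensor R T =>
      cases R with
      | tensor R S =>
        refine ⟨.tensor R (.tensor S T), forall_add.mpr ⟨fun x => ?_, forall_add.mpr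
          ⟨fun x => ?_, fun x => ?_⟩⟩, (splits_a R S T).2⟩
        · exact (color_castAdd R (.tensor S T) x).trans
            ((color_castAdd (.tensor R S) T _).trans (color_castAdd R S x)).symm
        · exact ((color_natAdd R (.tensor S T) _).trans (color_castAdd S T x)).trans
            ((color_castAdd (.tensor R S) T _).trans (color_natAdd R S x)).symm
        · exact ((color_natAdd R (.tensor S T) _).trans (color_natAdd S T x)).trans
            ((color_natAdd (.tensor R S) T x).symm.trans (congrArg _ (assocInv_three x).symm))
  | l A =>
    refine ⟨.tensor .unit T, forall_add.mpr ⟨fun x => x.elim0, fun x => ?_⟩, (splits_l T).1⟩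
    exact (color_natAdd .unit T x).trans (congrArg T.color (left_natAdd x).symm)
  | lInv A =>
    cases T with
    | tensor S T =>
      cases S
      refine ⟨T, fun x => ?_, (splits_l T).2⟩
      exact (color_natAdd .unit T x).symm.trans (congrArg _ (leftInv_eq x).symm)
  | r A =>
    refine ⟨.tensor T .unit, forall_add.mpr ⟨fun x => ?_, fun x => x.elim0⟩, (splits_r T).1⟩
    exact color_castAdd T .unit x
  | rInv A =>
    cases T with
    | tensor T S =>
      cases S
      exact ⟨T, fun x => (color_castAdd T .unit x).symm, (splits_r T).2⟩
  | c A B =>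
    cases T with
    | tensor S T =>
      refine ⟨.tensor T S, forall_add.mpr ⟨fun x => ?_, fun x => ?_⟩, splits_c T S⟩
      · simp only [graph, color_castAdd, color_natAdd, flip_castAdd]
      · simp only [graph, color_castAdd, color_natAdd, flip_natAdd]
  | psiL i A B =>
    cases T with
    | fn _ _ b =>
      -- The outermost generators of `B` fall under `Eⁱ` in the target, so all of them inherit its
      -- colour.
      refine ⟨.tensor (.fn i A b) (const b B), forall_add.mpr ⟨fun x => ?_, fun x => ?_⟩,
        splits_psiL i b A B⟩
      · exact color_castAdd (.fn i A b) (const b B) x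
      · exact (color_natAdd (.fn i A b) (const b B) x).trans (color_const b B x)
  | psiR i A B =>
    cases T with
    | fn _ _ b =>
      refine ⟨.tensor (const b A) (.fn i B b), forall_add.mpr ⟨fun x => ?_, fun x => ?_⟩,
        splits_psiR i b A B⟩
      · exact (color_castAdd (const b A) (.fn i B b) x).trans (color_const b A x)
      · exact color_natAdd (const b A) (.fn i B b) x

end Coloring

end LocallyLinear

namespace LocallyLinear

variable {P : Type u} {J : Type v}

/-! ### Formulae with at most one generator -/

/-- A formula without generators is canonically isomorphic to the unit. -/
theorem exists_canonical_unit : ∀ A : Formula P J, size A = 0 →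
    ∃ e : A ≅ 𝟙_ (Formula P J), Canonical e.hom ∧ Canonical e.inv
  | .unit, _ => ⟨Iso.refl _, .id _, .id _⟩
  | .tensor A B, h => by
    simp only [size] at h
    obtain ⟨d, hd, hd'⟩ := exists_canonical_unit A (by omega)
    obtain ⟨e, he, he'⟩ := exists_canonical_unit B (by omega)
    exact ⟨tensorIso d e ≪≫ λ_ _, .comp _ _ (.tensor _ _ hd he) (.l _),
      .comp _ _ (.lInv _) (.tensor _ _ hd' he')⟩
  | .fn _ A, h => by simp only [size] at h; omega
  | .var _, h => by simp only [size] at h; omega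

/-- Replace `B` by the unit through a canonical isomorphism; a crossing with the unit is a composite
of unitors. -/
theorem canonical_braiding {A B : Formula P J} (h : size B = 0) : Canonical (β_ A B).hom := by
  obtain ⟨e, he, he'⟩ := exists_canonical_unit B h
  have w : (β_ A B).hom = (𝟙 A ⊗ₘ e.hom) ≫ ((ρ_ A).hom ≫ (λ_ A).inv) ≫ (e.inv ⊗ₘ 𝟙 A) := by
    rw [← braiding_unit_hom, ← BraidedCategory.braiding_naturality, ← Category.assoc,
      tensorHom_comp_tensorHom, e.hom_inv_id, Category.comp_id, id_tensorHom_id, Category.id_comp]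
  rw [w]
  exact .comp _ _ (.tensor _ _ (.id _) he) (.comp _ _ (.comp _ _ (.r _) (.lInv _))
    (.tensor _ _ he' (.id _)))

theorem canonical_braiding' {A B : Formula P J} (h : size A = 0) : Canonical (β_ A B).hom := by
  obtain ⟨g, hg, e, -⟩ := canonical_inv (canonical_braiding (A := B) h)
  have w : (β_ A B).hom = g := by
    rw [← cancel_epi (β_ B A).hom, e, SymmetricCategory.symmetry]
  rwa [w]

/-- For `B` the unit, `psiL_r` solves for `psiL` in terms of right unitors; naturality transports
this along a canonical isomorphism from `B` to the unit. -/
theorem canonical_psiL (i : J) {A B : Formula P J} (h : size B = 0) : Canonical (psiL i A B) := by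
  obtain ⟨e, he, he'⟩ := exists_canonical_unit B h
  have w : psiL i A B = (𝟙 (Formula.fn i A) ⊗ₘ e.hom) ≫ (ρ_ (Formula.fn i A)).hom ≫
      fnMap i ((ρ_ A).inv ≫ (𝟙 A ⊗ₘ e.inv)) := by
    rw [← psiL_r, Category.assoc, ← fnMap_comp, Iso.hom_inv_id_assoc, ← psiL_natural, fnMap_id,
      ← Category.assoc, tensorHom_comp_tensorHom, e.hom_inv_id, Category.comp_id, id_tensorHom_id,
      Category.id_comp]
  rw [w]
  exact .comp _ _ (.tensor _ _ (.id _) he) (.comp _ _ (.r _)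
    (.fn i _ (.comp _ _ (.rInv _) (.tensor _ _ (.id _) he'))))

/-- With at most one generator, one side of every crossing is empty. In `psiL` and `psiR` the
functor is itself the only generator, so the formula it absorbs is empty. All three kinds of arrow
then reduce to canonical ones. -/
theorem canonical_arrow {A B : Formula P J} (f : Term A B) (h : size A ≤ 1) :
    Canonical (arrow f) := by
  induction f with
  | id A => exact .id A
  | comp f g ihf ihg =>
    -- The intermediate formula has the size of the source, since the graph of `f` is a bijection.
    refine .comp _ _ (ihf h) (ihg ?_)
    have := Fintype.card_of_bijective (graph_bijective f)
    simp only [Fintype.card_fin] at this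
    omega
  | tensor f g ihf ihg =>
    simp only [size] at h
    exact .tensor _ _ (ihf (by omega)) (ihg (by omega))
  | fn i f ih =>
    simp only [size] at h
    exact .fn i _ (ih (by omega))
  | a A B C => exact .a A B C
  | aInv A B C => exact .aInv A B C
  | l A => exact .l A
  | lInv A => exact .lInv A
  | r A => exact .r A
  | rInv A => exact .rInv A
  | c A B =>
    simp only [size] at h
    rcases Nat.eq_zero_or_pos (size A) with hA | hA
    · exact canonical_braiding' hA
    · exact canonical_braiding (by omega)
  | psiL i A B =>
    simp only [size] at h
    exact canonical_psiL i (by omega)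
  | psiR i A B =>
    simp only [size] at h
    have w := psiR_eq i A B
    change Canonical (psiR i A B)
    rw [w]
    exact .comp _ _ (canonical_braiding' (by omega)) (.comp _ _ (canonical_psiL i (by omega))
      (.fn i _ (canonical_braiding (by omega))))

/-! ### Coherence -/

/-- Arrows to `B` are determined by their graphs. -/
def Determined (B : Formula P J) : Prop :=
  ∀ ⦃A : Formula P J⦄ (f g : A ⟶ B), (G P J).map f = (G P J).map g → f = g

theorem Determined.of_iso {B C : Formula P J} (h : Determined C) (e : B ≅ C) : Determined B := by
  intro A f g w
  rw [← cancel_mono e.hom]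
  exact h _ _ (by rw [Functor.map_comp, Functor.map_comp, w])

theorem determined_of_size_le_one {B : Formula P J} (h : size B ≤ 1) : Determined B := by
  rintro A ⟨f⟩ ⟨g⟩ -
  have hA : size A ≤ 1 := by
    have := Fintype.card_of_bijective (graph_bijective f)
    simp only [Fintype.card_fin] at this
    omega
  exact canonical_isPreorderedGroupoid.preorder _ _ (canonical_arrow f hA) (canonical_arrow g hA)

theorem juxt_injective {m m' n n' : ℕ} {f f' : Fin m → Fin m'} {g g' : Fin n → Fin n'}
    (h : FinFun.juxt f g = FinFun.juxt f' g') : f = f' ∧ g = g' :=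
  ⟨funext fun x => Fin.castAdd_injective m' n' (by simpa using congrFun h (Fin.castAdd n x)),
    funext fun x => Fin.natAdd_injective n' m' (by simpa using congrFun h (Fin.natAdd m x))⟩

theorem map_tensorHom {A A' B B' : Formula P J} (f : A ⟶ A') (g : B ⟶ B') :
    (G P J).map (f ⊗ₘ g) = FinFun.juxt ((G P J).map f) ((G P J).map g) := by
  induction f using Quotient.ind
  induction g using Quotient.ind
  rfl

theorem map_fnMap (i : J) {A B : Formula P J} (f : A ⟶ B) :
    (G P J).map (fnMap i f) = FinFun.juxt (fun x : Fin 1 => x) ((G P J).map f) := by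
  induction f using Quotient.ind
  rfl

/-- Cancellation takes place among graphs, not among arrows: `Root.pull` comes with no inverse, but
its graph is surjective. -/
instance {A B : Formula P J} (f : A ⟶ B) : Epi ((G P J).map f) where
  left_cancellation g h w := by
    induction f using Quotient.ind with
    | _ f =>
      funext y
      obtain ⟨x, rfl⟩ := (graph_bijective f).2 y
      exact congrFun w x

/-- Colouring `B` and `C` differently reduces an arrow into `B ⊗ C` to one arrow into `B` and one
into `C`, along a splitting of the source that only the graph decides. -/
theorem Determined.tensor {B C : Formula P J} (hB : Determined B) (hC : Determined C) :
    Determined (B ⊗ C) := by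
  intro A f g w
  obtain ⟨d₁, d₂, -⟩ := Coloring.exists_split_const true B
  obtain ⟨e₁, e₂, -⟩ := Coloring.exists_split_const false C
  let T : Coloring (B ⊗ C) := .tensor (.const true B) (.const false C)
  -- The class of colour `true` is `B` tensored with an emptied copy of `C`, hence isomorphic to `B
  -- ⊗ I`; dually the other class is isomorphic to `I ⊗ C`.
  have h₁ : Determined T.restrict := hB.of_iso (tensorIso d₁.symm e₁.symm ≪≫ ρ_ B)
  have h₂ : Determined T.neg.restrict := hC.of_iso (tensorIso d₂.symm e₂.symm ≪≫ λ_ C)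
  induction f using Quotient.ind with
  | _ f =>
    induction g using Quotient.ind with
    | _ g =>
      obtain ⟨S, hS, f₁, f₂, hf⟩ := Coloring.exists_splits f T
      obtain ⟨S', hS', g₁, g₂, hg⟩ := Coloring.exists_splits g T
      obtain rfl : S = S' := Coloring.color_injective _ _ (funext fun x =>
        (hS x).trans ((congrArg T.color (congrFun w x)).trans (hS' x).symm))
      -- Both composites start with the same splitting of the source, whose graph can be cancelled.
      have e : (G P J).map (f₁ ⊗ₘ f₂) = (G P J).map (g₁ ⊗ₘ g₂) := by
        rw [← cancel_epi ((G P J).map S.split.hom), ← Functor.map_comp, ← Functor.map_comp, ← hf,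
          ← hg, Functor.map_comp, Functor.map_comp]
        exact congrArg (· ≫ (G P J).map T.split.hom) w
      rw [map_tensorHom, map_tensorHom] at e
      obtain ⟨k₁, k₂⟩ := juxt_injective e
      rw [h₁ f₁ g₁ k₁, h₂ f₂ g₂ k₂, ← hg] at hf
      exact (cancel_mono T.split.hom).mp hf

/-- An arrow into `Eⁱ B` is a pull of the occurrence that becomes the head, followed by `Eⁱ` of an
arrow into `B`; the graph determines both. -/
theorem Determined.fn (i : J) {B : Formula P J} (hB : Determined B) :
    Determined (Formula.fn i B) := by
  intro A f g w
  induction f using Quotient.ind with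
  | _ f =>
    induction g using Quotient.ind with
    | _ g =>
      obtain ⟨x, hx, h, hf⟩ := Root.exists_pull f (.here B)
      obtain ⟨y, hy, k, hg⟩ := Root.exists_pull g (.here B)
      -- Both occurrences are sent to the head by the common graph, which is injective, and an
      -- occurrence is determined by its position.
      obtain rfl : x = y := Root.pos_injective _ _ ((graph_bijective f).1
        (hx.trans (hy.symm.trans (congrFun w y.pos).symm)))
      -- The pull of the head of `Eⁱ B` is an identity, so the square is a factorisation of `f`.
      replace hf : arrow f = x.pull ≫ fnMap i h := (Category.comp_id _).symm.trans hf
      replace hg : arrow g = x.pull ≫ fnMap i k := (Category.comp_id _).symm.trans hg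
      have e : (G P J).map (fnMap i h) = (G P J).map (fnMap i k) := by
        rw [← cancel_epi ((G P J).map x.pull), ← Functor.map_comp, ← Functor.map_comp, ← hf, ← hg]
        exact w
      rw [map_fnMap, map_fnMap] at e
      change arrow f = arrow g
      rw [hf, hg, hB h k (juxt_injective e).2]

theorem determined : ∀ B : Formula P J, Determined B
  | .var _ => determined_of_size_le_one le_rfl
  | .unit => determined_of_size_le_one zero_le_one
  | .tensor A B => Determined.tensor (determined A) (determined B)
  | .fn i A => Determined.fn i (determined A)

end LocallyLinear

theorem proposition3 (P : Type u) (J : Type v) :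
    (LocallyLinear.H P J ⋙ LocallyLinear.G P J).Faithful ∧
      (LocallyLinear.G P J).Faithful := by
  have hG : (LocallyLinear.G P J).Faithful := ⟨fun h => LocallyLinear.determined _ _ _ h⟩
  have hH : (LocallyLinear.H P J).Faithful :=
    (LocallyLinear.canonical_isPreorderedGroupoid.fromStrict_isEquivalence).faithful
  exact ⟨Functor.Faithful.comp _ _, hG⟩
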